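/- Let $n\ge 1$ and let $M$ be an oriented $n$-dimensional smooth ($C^\infty$) Riemannian manifold without boundary, with metric $g=\langle\cdot,\cdot\rangle$, Riemannian volume form $\mathrm{vol}$ and Riemannian distance $d$ (with $d(x,y)=\infty$ if $x$ and $y$ lie in different components of $M$). Let $e_1,\dots,e_{n-1}: M\to\mathbb{R}$ be twice continuously differentiable functions, let $k_1,\dots,k_{n-1}>0$, and let the desired path be $$P=\{\xi\in M : e_1(\xi)=\dots=e_{n-1}(\xi)=0\}.$$ Let $\bot_e$ be the generalized cross product of the gradients of the $e_i$, that is, the vector field on $M$ with $$\langle \bot_e(\xi),v\rangle=\mathrm{vol}_\xi\big(\mathrm{grad}\,e_1(\xi),\dots,\mathrm{grad}\,e_{n-1}(\xi),v\big)\qquad\text{for all } \xi\in M,\ v\in T_\xi M,$$ and let the guiding vector field be $$\chi(\xi)=\bot_e(\xi)-\sum_{i=1}^{n-1}k_i\,e_i(\xi)\,\mathrm{grad}\,e_i(\xi).$$ Let $C=\{\xi\in M:\chi(\xi)=0\}$ be its singular set, and suppose that $C=\emptyset$ or $\mathrm{dist}(C,P)=\inf\{d(\xi,q):\xi\in C,\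 q\in P\}>0$. Suppose that $P$ is homeomorphic to the unit circle $\mathbb{S}^1$ and that $P$ is asymptotically stable for $\dot\xi(t)=\chi(\xi(t))$: for every $\varepsilon>0$ there is $\delta>0$ such that every trajectory with $\mathrm{dist}(\xi(0),P)<\delta$ exists for all $t\ge 0$ and satisfies $\mathrm{dist}(\xi(t),P)<\varepsilon$ for all $t\ge0$; and there is $\delta>0$ such that every trajectory with $\mathrm{dist}(\xi(0),P)<\delta$ exists for all $t\ge 0$ and satisfies $\mathrm{dist}(\xi(t),P)\to0$ as $t\to\infty$. Then the domain of attraction of $P$, i.e. the set of all $\xi_0\in M$ such that the trajectory with $\xi(0)=\xi_0$ exists for all $t\ge0$ and $\mathrm{dist}(\xi(t),P)\to0$ as $t\to\infty$, is, with the subspace topology, homeomorphic to $\mathbb{R}^{n-1}\times\mathbb{S}^1$. -/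

import Mathlib

open Set Filter Bundle
open scoped Manifold Topology ContDiff ENNReal RealInnerProductSpace

namespace GVF

section Riemannian

variable {m : ℕ} {M : Type*} [TopologicalSpace M]
  [ChartedSpace (EuclideanSpace ℝ (Fin (m + 1))) M]

/-- The tangent spaces of an `(m + 1)`-dimensional manifold are finite-dimensional. -/
instance finiteDimensional_tangentSpace (x : M) :
    FiniteDimensional ℝ (TangentSpace (𝓡 (m + 1)) x) :=
  inferInstanceAs (FiniteDimensional ℝ (EuclideanSpace ℝ (Fin (m + 1))))

/-- The tangent spaces of an `(m + 1)`-dimensional manifold have dimension `m + 1`. -/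
instance fact_finrank_tangentSpace (x : M) :
    Fact (Module.finrank ℝ (TangentSpace (𝓡 (m + 1)) x) = m + 1) :=
  ⟨finrank_euclideanSpace_fin (𝕜 := ℝ) (n := m + 1)⟩

/-- An orientation of an `(m + 1)`-dimensional smooth manifold: a choice of an orientation of every
tangent space such that every point has a neighborhood carrying a smooth local frame that is
positively oriented at each of its points. -/
structure ManifoldOrientation (m : ℕ) (M : Type*) [TopologicalSpace M]
    [ChartedSpace (EuclideanSpace ℝ (Fin (m + 1))) M] [IsManifold (𝓡 (m + 1)) ∞ M] where
  /-- The orientation of the tangent space at a point. -/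
  at_point : ∀ x : M, Orientation ℝ (TangentSpace (𝓡 (m + 1)) x) (Fin (m + 1))
  /-- Existence of positively oriented smooth local frames. -/
  exists_frame : ∀ x₀ : M, ∃ U ∈ 𝓝 x₀,
    ∃ X : Fin (m + 1) → ∀ x : M, TangentSpace (𝓡 (m + 1)) x,
    ∃ hX : IsLocalFrameOn (𝓡 (m + 1)) (EuclideanSpace ℝ (Fin (m + 1))) ∞ X U,
      ∀ (x : M) (hx : x ∈ U), (hX.toBasisAt hx).orientation = at_point x

variable [RiemannianBundle (fun x : M => TangentSpace (𝓡 (m + 1)) x)]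

/-- The vector that represents a linear form on a tangent space through the Riemannian metric:
`⟪sharp x φ, v⟫ = φ v` for every tangent vector `v` at `x`. -/
noncomputable def sharp (x : M) (φ : TangentSpace (𝓡 (m + 1)) x →L[ℝ] ℝ) :
    TangentSpace (𝓡 (m + 1)) x :=
  haveI : CompleteSpace (TangentSpace (𝓡 (m + 1)) x) := FiniteDimensional.complete ℝ _
  (InnerProductSpace.toDual ℝ (TangentSpace (𝓡 (m + 1)) x)).symm φ

theorem inner_sharp (x : M) (φ : TangentSpace (𝓡 (m + 1)) x →L[ℝ] ℝ)
    (v : TangentSpace (𝓡 (m + 1)) x) : ⟪sharp x φ, v⟫ = φ v := by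
  have : CompleteSpace (TangentSpace (𝓡 (m + 1)) x) := FiniteDimensional.complete ℝ _
  exact InnerProductSpace.toDual_symm_apply

/-- The Riemannian gradient of a real function: `⟪grad f x, v⟫ = df_x(v)`. -/
noncomputable def grad (f : M → ℝ) (x : M) : TangentSpace (𝓡 (m + 1)) x :=
  sharp x (mvfderiv (𝓡 (m + 1)) f x)

variable [IsManifold (𝓡 (m + 1)) ∞ M]

/-- The linear form `v ↦ vol_x (grad e₁ (x), …, grad e_m (x), v)`, where `vol` is the Riemannian
volume form of the oriented manifold. -/
noncomputable def perpForm (o : ManifoldOrientation m M) (e : Fin m → M → ℝ) (x : M) :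
    TangentSpace (𝓡 (m + 1)) x →L[ℝ] ℝ :=
  LinearMap.toContinuousLinearMap
    ((o.at_point x).volumeForm.toMultilinearMap.toLinearMap
      (Fin.snoc (α := fun _ => TangentSpace (𝓡 (m + 1)) x)
        (fun i => grad (e i) x) 0) (Fin.last m))

theorem perpForm_apply (o : ManifoldOrientation m M) (e : Fin m → M → ℝ) (x : M)
    (v : TangentSpace (𝓡 (m + 1)) x) :
    perpForm o e x v = (o.at_point x).volumeForm
      (Fin.snoc (α := fun _ => TangentSpace (𝓡 (m + 1)) x) (fun i => grad (e i) x) v) := by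
  have h : Function.update (Fin.snoc (α := fun _ => TangentSpace (𝓡 (m + 1)) x)
      (fun i => grad (e i) x) 0) (Fin.last m) v =
      Fin.snoc (α := fun _ => TangentSpace (𝓡 (m + 1)) x) (fun i => grad (e i) x) v := by
    ext1 j
    refine Fin.lastCases ?_ (fun i => ?_) j <;> simp
  simp [perpForm, h]

/-- The generalized cross product `⊥_e` of the gradients `grad e₁, …, grad e_m`: the vector field
with `⟪⊥_e (x), v⟫ = vol_x (grad e₁ (x), …, grad e_m (x), v)` for all tangent vectors `v`. -/
noncomputable def perp (o : ManifoldOrientation m M) (e : Fin m → M → ℝ) (x : M) :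
    TangentSpace (𝓡 (m + 1)) x :=
  sharp x (perpForm o e x)

/-- The guiding vector field `χ = ⊥_e - ∑ i, kᵢ eᵢ grad eᵢ`. -/
noncomputable def guidingField (o : ManifoldOrientation m M) (e : Fin m → M → ℝ) (k : Fin m → ℝ)
    (x : M) : TangentSpace (𝓡 (m + 1)) x :=
  perp o e x - ∑ i, (k i * e i x) • grad (e i) x

/-- The singular set of the guiding vector field. -/
def singularSet (o : ManifoldOrientation m M) (e : Fin m → M → ℝ) (k : Fin m → ℝ) : Set M :=
  {x | guidingField o e k x = 0}

end Riemannian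

/-- The desired path: the common zero set of the surface functions. -/
def desiredPath {m : ℕ} {M : Type*} (e : Fin m → M → ℝ) : Set M :=
  {x | ∀ i, e i x = 0}

/-- The distance `inf {d(x, y) : x ∈ A, y ∈ B}` of two sets (`∞` if one of them is empty). -/
noncomputable def setDist {M : Type*} [EMetricSpace M] (A B : Set M) : ℝ≥0∞ :=
  ⨅ x ∈ A, ⨅ y ∈ B, edist x y

section Dynamics

variable {m : ℕ} {M : Type*} [EMetricSpace M]
  [ChartedSpace (EuclideanSpace ℝ (Fin (m + 1))) M]

/-- `γ` restricted to `[0, ∞)` is a trajectory of `ẋ = v(x)` that starts at `x₀`. -/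
def IsTrajectory (v : ∀ x : M, TangentSpace (𝓡 (m + 1)) x) (x₀ : M) (γ : ℝ → M) : Prop :=
  γ 0 = x₀ ∧ IsMIntegralCurveOn γ v (Ici 0)

/-- The curve `γ` converges to the set `A`: the distance of `γ t` to `A` tends to `0`. -/
def ConvergesTo (γ : ℝ → M) (A : Set M) : Prop :=
  Tendsto (fun t => Metric.infEDist (γ t) A) atTop (𝓝 0)

/-- Asymptotic stability of a set `A` for `ẋ = v(x)`: trajectories that start close to `A` exist for
all nonnegative times, stay close to `A`, and converge to `A`. -/
structure IsAsymptoticallyStable (v : ∀ x : M, TangentSpace (𝓡 (m + 1)) x) (A : Set M) : Prop where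
  stable : ∀ ε > (0 : ℝ≥0∞), ∃ δ > (0 : ℝ≥0∞), ∀ x₀ : M, Metric.infEDist x₀ A < δ →
    (∃ γ : ℝ → M, IsTrajectory v x₀ γ) ∧
    ∀ γ : ℝ → M, IsTrajectory v x₀ γ → ∀ t ≥ (0 : ℝ), Metric.infEDist (γ t) A < ε
  attractive : ∃ δ > (0 : ℝ≥0∞), ∀ x₀ : M, Metric.infEDist x₀ A < δ →
    (∃ γ : ℝ → M, IsTrajectory v x₀ γ) ∧
    ∀ γ : ℝ → M, IsTrajectory v x₀ γ → ConvergesTo γ A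

/-- The domain of attraction of `A` for `ẋ = v(x)`: the set of initial conditions from which the
trajectory exists for all nonnegative times and converges to `A`. -/
def domainOfAttraction (v : ∀ x : M, TangentSpace (𝓡 (m + 1)) x) (A : Set M) : Set M :=
  {x₀ | ∃ γ : ℝ → M, IsTrajectory v x₀ γ ∧ ConvergesTo γ A}

end Dynamics

end GVF

/-! ### Local flows, trapping regions and entry times -/

namespace GVF

/-! Put `y = (√k₁ e₁, …, √k_m e_m)`, so that `P = {y = 0}` and `‖y‖² = ∑ kᵢ eᵢ²`. Since `⊥_e` is
orthogonal to every `grad eᵢ`, the derivative of `‖y‖²` along `χ` is `-2 ‖g‖²` with `g = ∑ kᵢ eᵢ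
grad eᵢ`. If `g = 0` off `P`, the gradients are dependent, hence `⊥_e = 0` and `χ = 0`
(`guidingField_eq_zero`). So `‖y‖` decreases strictly along orbits that avoid `P` and the singular
set.

No singular point lies on `P`, so the gradients are independent there, and the compact set `P` has a
neighborhood on which `y` together with a retraction `ρ` onto `P` are product coordinates
(`exists_trivialization_levelMap`). Orbits that start near `P` converge to `P` and so meet no
singular point off `P`. Hence, for small `r`, the part `N` of this neighborhood with `‖y‖ ≤ r` is a
trapping region (`LocalFlow.exists_isTrap`), homeomorphic to a closed ball times `P`. The domain of
attraction is exactly the set of points whose orbits reach `N`, the basin of `N`.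

It remains to show that the basin is the open version of `N`. A point outside `N` is determined by
its entry point, which lies on `‖y‖ = r`, and by its entry time, and both depend continuously on it.
Backward orbits may cease to exist after a finite time, so the entry time is replaced by a clock
that is strictly increasing and tends to infinity wherever the backward orbit ends. With `h` the
clock time elapsed before entry, the map sending `x` to `((1 + h) y, ρ)`, with `y` and `ρ` taken at
the entry point, is a continuous proper bijection of the basin onto `ℝᵐ × P`, hence a homeomorphism
(`IsTrap.nonempty_homeomorph`). The circle enters only through `P ≃ₜ Circle`. -/

/-- A local flow on a topological space: `rel t x y` says that the point `x` moves to the point `y`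
within the time `t ≥ 0`. -/
structure LocalFlow (X : Type*) [TopologicalSpace X] where
  /-- The point `x` moves to `y` within the time `t`. -/
  rel : ℝ → X → X → Prop
  nonneg : ∀ {t x y}, rel t x y → 0 ≤ t
  eq_of_zero : ∀ {x y}, rel 0 x y → x = y
  trans : ∀ {s t x y z}, rel s x y → rel t y z → rel (s + t) x z
  split : ∀ {s t x z}, rel t x z → 0 ≤ s → s ≤ t → ∃ y, rel s x y ∧ rel (t - s) y z
  unique : ∀ {t x y y'}, rel t x y → rel t x y' → y = y'
  injective : ∀ {t x x' y}, rel t x y → rel t x' y → x = x'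
  -- Openness of the domain and continuity of the flow in one condition; the guard `0 ≤ p.1` matters
  -- at `t = 0`, where nearby times may be negative.
  cont : ∀ {t x y}, rel t x y → ∀ W ∈ 𝓝 y,
    ∀ᶠ p : ℝ × X in 𝓝 (t, x), 0 ≤ p.1 → ∃ y' ∈ W, rel p.1 p.2 y'
  cont_rev : ∀ {t x y}, rel t x y → ∀ W ∈ 𝓝 x,
    ∀ᶠ p : ℝ × X in 𝓝 (t, y), 0 ≤ p.1 → ∃ x' ∈ W, rel p.1 x' p.2

namespace LocalFlow

section Topological

variable {X : Type*} [TopologicalSpace X] (L : LocalFlow X)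

theorem refl_left {t : ℝ} {x y : X} (h : L.rel t x y) : L.rel 0 x x := by
  obtain ⟨z, hz, -⟩ := L.split h le_rfl (L.nonneg h)
  have := L.eq_of_zero hz
  exact this ▸ hz

theorem rel_of_rel {s t : ℝ} {x y z : X} (h : L.rel t x z) (hs : L.rel s x y) (hst : s ≤ t) :
    L.rel (t - s) y z := by
  obtain ⟨y', h1, h2⟩ := L.split h (L.nonneg hs) hst
  exact L.unique hs h1 ▸ h2

/-- A trapping region of a local flow: a compact set `N`, described by a function `y`, into the
interior of which the flow points. -/
structure IsTrap {E : Type*} [NormedAddCommGroup E] (N : Set X) (y : X → E) (r : ℝ) : Prop where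
  isCompact : IsCompact N
  isClosed : IsClosed N
  continuousOn : ContinuousOn y N
  norm_le : ∀ x ∈ N, ‖y x‖ ≤ r
  -- Openness in the whole space: the boundary of `N` lies in the level `‖y‖ = r`, so orbits can
  -- enter only there.
  isOpen : IsOpen {x | x ∈ N ∧ ‖y x‖ < r}
  strict : ∀ x ∈ N, ∀ t > 0, ∃ z, L.rel t x z ∧ z ∈ N ∧ ‖y z‖ < r

/-- The basin of a set: the points that reach the set. -/
def basin (N : Set X) : Set X := {x | ∃ t z, L.rel t x z ∧ z ∈ N}

variable {L} {E : Type*} [NormedAddCommGroup E] {N : Set X} {y : X → E} {r : ℝ}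

namespace IsTrap

theorem refl (hN : L.IsTrap N y r) {x : X} (hx : x ∈ N) : L.rel 0 x x := by
  obtain ⟨z, hz, -⟩ := hN.strict x hx 1 one_pos
  exact L.refl_left hz

theorem image_mem (hN : L.IsTrap N y r) {t : ℝ} {x z : X} (hx : x ∈ N) (h : L.rel t x z) :
    z ∈ N := by
  rcases (L.nonneg h).eq_or_lt with rfl | ht
  · exact L.eq_of_zero h ▸ hx
  · obtain ⟨z', hz', hm, -⟩ := hN.strict x hx t ht
    exact L.unique h hz' ▸ hm

theorem norm_image_lt (hN : L.IsTrap N y r) {t : ℝ} {x z : X} (hx : x ∈ N) (ht : 0 < t)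
    (h : L.rel t x z) : ‖y z‖ < r := by
  obtain ⟨z', hz', -, hm⟩ := hN.strict x hx t ht
  exact L.unique h hz' ▸ hm

theorem exists_image (hN : L.IsTrap N y r) {x : X} (hx : x ∈ L.basin N) {t : ℝ} (ht : 0 ≤ t) :
    ∃ z, L.rel t x z := by
  obtain ⟨s, w, hw, hwN⟩ := hx
  rcases le_or_gt t s with h | h
  · obtain ⟨z, hz, -⟩ := L.split hw ht h
    exact ⟨z, hz⟩
  · obtain ⟨z, hz, -⟩ := hN.strict w hwN (t - s) (sub_pos.2 h)
    exact ⟨z, by simpa using L.trans hw hz⟩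

/-- The times at which the orbit lies in the closed set `N` form a closed set bounded below by `0`,
so their infimum is attained. -/
theorem exists_first_hit (hN : L.IsTrap N y r) {x : X} (hx : x ∈ L.basin N) :
    ∃ t z, L.rel t x z ∧ z ∈ N ∧ ∀ s w, L.rel s x w → w ∈ N → t ≤ s := by
  set T : Set ℝ := {t | ∃ z, L.rel t x z ∧ z ∈ N} with hT
  have hclosed : IsClosed T := by
    rw [← isOpen_compl_iff, isOpen_iff_mem_nhds]
    intro t ht
    rcases lt_or_ge t 0 with h0 | h0
    · filter_upwards [gt_mem_nhds h0] with s hs hsT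
      obtain ⟨z, hz, -⟩ := hsT
      exact absurd (L.nonneg hz) (not_le.2 hs)
    · obtain ⟨z, hz⟩ := hN.exists_image hx h0
      have hzN : z ∉ N := fun h => ht ⟨z, hz, h⟩
      have h1 := L.cont hz Nᶜ (hN.isClosed.isOpen_compl.mem_nhds hzN)
      have h2 : Tendsto (fun s : ℝ => (s, x)) (𝓝 t) (𝓝 (t, x)) :=
        (Continuous.prodMk_left x).tendsto t
      filter_upwards [h2.eventually h1] with s hs hsT
      obtain ⟨w, hw, hwN⟩ := hsT
      obtain ⟨w', hw', hr⟩ := hs (L.nonneg hw)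
      exact hw' (L.unique hw hr ▸ hwN)
  have hne : T.Nonempty := by
    obtain ⟨t, z, hz, hzN⟩ := hx
    exact ⟨t, z, hz, hzN⟩
  have hbdd : BddBelow T := ⟨0, fun t ⟨z, hz, _⟩ => L.nonneg hz⟩
  obtain ⟨z, hz, hzN⟩ := hclosed.csInf_mem hne hbdd
  exact ⟨sInf T, z, hz, hzN, fun s w hs hw => csInf_le hbdd ⟨w, hs, hw⟩⟩

end IsTrap

variable (L N) in
open Classical in
/-- The time at which a point of the basin of `N` enters `N`. -/
noncomputable def hitTime (x : X) : ℝ :=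
  if h : ∃ t z, L.rel t x z ∧ z ∈ N ∧ ∀ s w, L.rel s x w → w ∈ N → t ≤ s then h.choose else 0

variable (L N) in
open Classical in
/-- The point at which a point of the basin of `N` enters `N`. -/
noncomputable def hitPoint (x : X) : X :=
  if h : ∃ z, L.rel (L.hitTime N x) x z then h.choose else x

namespace IsTrap

theorem hit_spec (hN : L.IsTrap N y r) {x : X} (hx : x ∈ L.basin N) :
    L.rel (L.hitTime N x) x (L.hitPoint N x) ∧ L.hitPoint N x ∈ N ∧
      ∀ s w, L.rel s x w → w ∈ N → L.hitTime N x ≤ s := by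
  have h := hN.exists_first_hit hx
  have hτ : L.hitTime N x = h.choose := by simp only [hitTime, dif_pos h]
  obtain ⟨z, hz, hzN, hmin⟩ := h.choose_spec
  rw [← hτ] at hz hmin
  have h' : ∃ z, L.rel (L.hitTime N x) x z := ⟨z, hz⟩
  have hp : L.hitPoint N x = h'.choose := by rw [hitPoint, dif_pos h']
  have hp' : L.rel (L.hitTime N x) x (L.hitPoint N x) := hp ▸ h'.choose_spec
  exact ⟨hp', L.unique hz hp' ▸ hzN, hmin⟩

theorem rel_hit (hN : L.IsTrap N y r) {x : X} (hx : x ∈ L.basin N) :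
    L.rel (L.hitTime N x) x (L.hitPoint N x) := (hN.hit_spec hx).1

theorem hitPoint_mem (hN : L.IsTrap N y r) {x : X} (hx : x ∈ L.basin N) :
    L.hitPoint N x ∈ N := (hN.hit_spec hx).2.1

theorem hitTime_le (hN : L.IsTrap N y r) {s : ℝ} {x w : X} (h : L.rel s x w) (hw : w ∈ N) :
    L.hitTime N x ≤ s := (hN.hit_spec ⟨s, w, h, hw⟩).2.2 s w h hw

theorem hitTime_nonneg (hN : L.IsTrap N y r) {x : X} (hx : x ∈ L.basin N) :
    0 ≤ L.hitTime N x := L.nonneg (hN.rel_hit hx)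

theorem mem_of_hitTime_lt (hN : L.IsTrap N y r) {x : X} (hx : x ∈ L.basin N) {t : ℝ} {z : X}
    (h : L.rel t x z) (ht : L.hitTime N x < t) : z ∈ N ∧ ‖y z‖ < r := by
  have h1 := L.rel_of_rel h (hN.rel_hit hx) ht.le
  exact ⟨hN.image_mem (hN.hitPoint_mem hx) h1,
    hN.norm_image_lt (hN.hitPoint_mem hx) (sub_pos.2 ht) h1⟩

/-- At an entry point with `‖y‖ < r`, which is interior to `N`, the orbit would already have been in
`N` slightly earlier. -/
theorem norm_hitPoint (hN : L.IsTrap N y r) {x : X} (hx : x ∈ L.basin N)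
    (h0 : 0 < L.hitTime N x) : ‖y (L.hitPoint N x)‖ = r := by
  by_contra hne
  have hlt := lt_of_le_of_ne (hN.norm_le _ (hN.hitPoint_mem hx)) hne
  have h1 := L.cont (hN.rel_hit hx) _ (hN.isOpen.mem_nhds ⟨hN.hitPoint_mem hx, hlt⟩)
  have h2 : Tendsto (fun s : ℝ => (s, x)) (𝓝[<] L.hitTime N x) (𝓝 (L.hitTime N x, x)) :=
    ((Continuous.prodMk_left x).tendsto _).mono_left nhdsWithin_le_nhds
  have h3 : ∀ᶠ s in 𝓝[<] L.hitTime N x, 0 < s :=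
    nhdsWithin_le_nhds (lt_mem_nhds h0)
  obtain ⟨s, hs, hs0, hsl⟩ := ((h2.eventually h1).and (h3.and self_mem_nhdsWithin)).exists
  obtain ⟨w, hw, hr⟩ := hs hs0.le
  exact absurd (hN.hitTime_le hr hw.1) (not_le.2 hsl)

/-- After an earlier entry the orbit would be strictly below the level `r`, so a point on that level
can only be the entry point. -/
theorem hit_eq (hN : L.IsTrap N y r) {t : ℝ} {x s : X} (h : L.rel t x s) (hs : s ∈ N)
    (ht : t = 0 ∨ ‖y s‖ = r) : L.hitTime N x = t ∧ L.hitPoint N x = s := by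
  have hx : x ∈ L.basin N := ⟨t, s, h, hs⟩
  have hτ : L.hitTime N x = t := by
    refine le_antisymm (hN.hitTime_le h hs) ?_
    by_contra! hlt
    rcases ht with rfl | ht
    · exact absurd (hN.hitTime_nonneg hx) (not_le.2 hlt)
    · exact absurd ht (hN.mem_of_hitTime_lt hx h hlt).2.ne
  exact ⟨hτ, L.unique (hN.rel_hit hx) (hτ ▸ h)⟩

theorem subset_basin (hN : L.IsTrap N y r) : N ⊆ L.basin N := fun x hx => ⟨0, x, hN.refl hx, hx⟩

/-- Just before entry the orbit is in the open complement of `N`, and just after it in the open set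
`‖y‖ < r` of `N`. Nearby orbits inherit both, and forward invariance of `N` turns this into lower
and upper bounds on their entry times. -/
theorem continuous_hitTime (hN : L.IsTrap N y r) :
    Continuous fun x : L.basin N => L.hitTime N x := by
  rw [continuous_iff_continuousAt]
  rintro ⟨x, hx⟩
  refine tendsto_order.2 ⟨fun a ha => ?_, fun b hb => ?_⟩
  · dsimp only at ha ⊢
    rcases lt_or_ge a 0 with h0 | h0
    · exact Eventually.of_forall fun x' => h0.trans_le (hN.hitTime_nonneg x'.2)
    obtain ⟨c, hac, hc⟩ := exists_between ha
    obtain ⟨z, hz⟩ := hN.exists_image hx (h0.trans hac.le)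
    have hzN : z ∉ N := fun h => absurd (hN.hitTime_le hz h) (not_le.2 hc)
    have h1 := L.cont hz Nᶜ (hN.isClosed.isOpen_compl.mem_nhds hzN)
    have h2 : Tendsto (fun x' : L.basin N => (c, (x' : X))) (𝓝 ⟨x, hx⟩) (𝓝 (c, x)) :=
      ((Continuous.prodMk_right c).comp continuous_subtype_val).tendsto (⟨x, hx⟩ : L.basin N)
    filter_upwards [h2.eventually h1] with x' hx'
    obtain ⟨w, hw, hr⟩ := hx' (h0.trans hac.le)
    refine hac.trans_le ?_
    by_contra! hlt
    exact hw (hN.mem_of_hitTime_lt x'.2 hr hlt).1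
  · dsimp only at hb ⊢
    obtain ⟨c, hc, hcb⟩ := exists_between hb
    have hc0 := (hN.hitTime_nonneg hx).trans hc.le
    obtain ⟨z, hz⟩ := hN.exists_image hx hc0
    have h1 := L.cont hz _ (hN.isOpen.mem_nhds (hN.mem_of_hitTime_lt hx hz hc))
    have h2 : Tendsto (fun x' : L.basin N => (c, (x' : X))) (𝓝 ⟨x, hx⟩) (𝓝 (c, x)) :=
      ((Continuous.prodMk_right c).comp continuous_subtype_val).tendsto (⟨x, hx⟩ : L.basin N)
    filter_upwards [h2.eventually h1] with x' hx'
    obtain ⟨w, hw, hr⟩ := hx' hc0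
    exact (hN.hitTime_le hr hw.1).trans_lt hcb

theorem continuous_hitPoint (hN : L.IsTrap N y r) :
    Continuous fun x : L.basin N => L.hitPoint N x := by
  rw [continuous_iff_continuousAt]
  rintro ⟨x, hx⟩ W hW
  have h1 := L.cont (hN.rel_hit hx) W hW
  have h2 : Tendsto (fun x' : L.basin N => (L.hitTime N x', (x' : X))) (𝓝 ⟨x, hx⟩)
      (𝓝 (L.hitTime N x, x)) :=
    (hN.continuous_hitTime.prodMk continuous_subtype_val).tendsto (⟨x, hx⟩ : L.basin N)
  rw [mem_map]
  filter_upwards [h2.eventually h1] with x' hx'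
  obtain ⟨w, hw, hr⟩ := hx' (hN.hitTime_nonneg x'.2)
  rw [L.unique hr (hN.rel_hit x'.2)] at hw
  exact hw

end IsTrap

/-! ### Product coordinates near a compact fiber -/

/-- A local flow over the translations of a normed space, given by a function `y`, yields a
trivialization of `y` near a compact fiber. -/
theorem exists_trivialization {E : Type*} [NormedAddCommGroup E] [NormedSpace ℝ E] [T2Space X]
    [ProperSpace E] (L : LocalFlow (X × E)) {y : X → E} (hy : Continuous y)
    (hP : IsCompact {x | y x = 0}) [Nonempty {x | y x = 0}]
    (h_snd : ∀ {t x c z}, L.rel t (x, c) z → z.2 = c ∧ y z.1 = y x + t • c)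
    (h_symm : ∀ {t x c x'}, L.rel t (x, c) (x', c) → L.rel t (x', -c) (x, -c))
    (h_zero : ∀ x, y x = 0 → L.rel 1 (x, 0) (x, 0)) :
    ∃ r > 0, ∃ N : Set X, ∃ ρ : X → {x | y x = 0}, IsCompact N ∧ N ∈ 𝓝ˢ {x | y x = 0} ∧
      ContinuousOn ρ N ∧ InjOn (fun x => (y x, ρ x)) N ∧
      ∀ c, ‖c‖ ≤ r → ∀ p, ∃ x ∈ N, y x = c ∧ ρ x = p := by
  classical
  set P : Set X := {x | y x = 0} with hPdef
  set Ω : Set (X × E) := {a | ∃ z, L.rel 1 a z} with hΩ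
  have hcont : ∀ {a z}, L.rel 1 a z → ∀ W ∈ 𝓝 z, ∀ᶠ b in 𝓝 a, ∃ z' ∈ W, L.rel 1 b z' := by
    intro a z h W hW
    have h2 : Tendsto (fun b : X × E => ((1 : ℝ), b)) (𝓝 a) (𝓝 (1, a)) :=
      (Continuous.prodMk_right 1).tendsto _
    filter_upwards [h2.eventually (L.cont h W hW)] with b hb using hb zero_le_one
  have hΩo : IsOpen Ω := by
    rw [isOpen_iff_mem_nhds]
    rintro a ⟨z, hz⟩
    filter_upwards [hcont hz univ univ_mem] with b hb
    obtain ⟨z', -, hz'⟩ := hb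
    exact ⟨z', hz'⟩
  -- `Φ (x, c)` is the time-one map with velocity `c`. Carrying `c` as a component of the state
  -- makes continuity in the parameter part of the continuity of the flow.
  set Φ : X × E → X := fun a => if h : ∃ z, L.rel 1 a z then h.choose.1 else a.1 with hΦ
  have hΦ' : ∀ a ∈ Ω, L.rel 1 a (Φ a, a.2) := by
    rintro ⟨x, c⟩ ha
    have h1 : Φ (x, c) = ha.choose.1 := dif_pos ha
    have h2 := h_snd ha.choose_spec
    have h3 : (Φ (x, c), c) = ha.choose := Prod.ext h1 h2.1.symm
    exact h3 ▸ ha.choose_spec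
  have hΦc : ContinuousOn Φ Ω := by
    intro a ha
    refine ContinuousAt.continuousWithinAt ?_
    intro W hW
    have h3 : Prod.fst ⁻¹' W ∈ 𝓝 (Φ a, a.2) := continuous_fst.continuousAt.preimage_mem_nhds hW
    rw [mem_map]
    filter_upwards [hcont (hΦ' a ha) _ h3] with b hb
    obtain ⟨z', hz', hr⟩ := hb
    have := L.unique hr (hΦ' b ⟨z', hr⟩)
    rw [this] at hz'
    exact hz'
  -- Points of the fiber rest when `c = 0`, so the open domain `Ω` contains `P × {0}`, and by
  -- compactness a whole tube around it.
  obtain ⟨U, V, hU, hV, hPU, h0V, hUV⟩ := generalized_tube_lemma hP (isCompact_singleton (x := (0 : E)))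
    hΩo (by rintro ⟨x, c⟩ ⟨hx, hc⟩; obtain rfl : c = 0 := hc; exact ⟨_, h_zero x hx⟩)
  obtain ⟨r, hr, hrV⟩ := Metric.nhds_basis_closedBall.mem_iff.1 (hV.mem_nhds (h0V rfl))
  have hsub : P ×ˢ Metric.closedBall (0 : E) r ⊆ Ω :=
    (prod_mono hPU hrV).trans hUV
  set N := Φ '' (P ×ˢ Metric.closedBall (0 : E) r) with hNdef
  have hneg : ∀ {a}, a ∈ Ω → L.rel 1 (Φ a, -a.2) (a.1, -a.2) := fun {a} ha => h_symm (hΦ' a ha)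
  have hyΦ : ∀ a ∈ Ω, y (Φ a) = y a.1 + a.2 := by
    rintro ⟨x, c⟩ ha
    simpa using (h_snd (hΦ' _ ha)).2
  have hback : ∀ a ∈ P ×ˢ Metric.closedBall (0 : E) r,
      (Φ a, -y (Φ a)) ∈ Ω ∧ Φ (Φ a, -y (Φ a)) = a.1 ∧ y (Φ a) = a.2 := by
    rintro a ha
    have hya : y (Φ a) = a.2 := by rw [hyΦ a (hsub ha), show y a.1 = 0 from ha.1, zero_add]
    rw [hya]
    have h1 := hneg (hsub ha)
    have h2 : (Φ a, -a.2) ∈ Ω := ⟨_, h1⟩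
    exact ⟨h2, congrArg Prod.fst (L.unique (hΦ' _ h2) h1), rfl⟩
  -- Flowing with velocity `-y x` for unit time brings `y` to `0` and undoes `Φ`; this is the
  -- projection onto the fiber.
  set ρ : X → P := fun x => if h : Φ (x, -y x) ∈ P then ⟨_, h⟩ else Classical.arbitrary _ with hρ
  have hρ' : ∀ a ∈ P ×ˢ Metric.closedBall (0 : E) r, (ρ (Φ a) : X) = a.1 := by
    intro a ha
    have h1 : Φ (Φ a, -y (Φ a)) ∈ P := (hback a ha).2.1 ▸ ha.1
    simp only [hρ, dif_pos h1, (hback a ha).2.1]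
  have hρN : ∀ x ∈ N, (ρ x : X) = Φ (x, -y x) := by
    rintro _ ⟨a, ha, rfl⟩
    rw [hρ' a ha, (hback a ha).2.1]
  refine ⟨r, hr, N, ρ, (hP.prod (isCompact_closedBall _ _)).image_of_continuousOn (hΦc.mono hsub),
    ?_, ?_, ?_, ?_⟩
  -- A point `x` close to the fiber is `Φ (p, y x)` with `p = Φ (x, -y x)`, so `N` contains a
  -- neighborhood of the fiber.
  · have hopen : IsOpen {x | x ∈ U ∧ -y x ∈ V ∧ ‖y x‖ < r} :=
      hU.inter ((hV.preimage hy.neg).inter (isOpen_lt hy.norm continuous_const))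
    refine mem_of_superset (hopen.mem_nhdsSet.2 ?_) ?_
    · intro x hx
      have hx0 : y x = 0 := hx
      exact ⟨hPU hx, by simpa [hx0] using h0V rfl, by simpa [hx0] using hr⟩
    · rintro x ⟨hxU, hxV, hxr⟩
      have hm : (x, -y x) ∈ Ω := hUV ⟨hxU, hxV⟩
      have hp : Φ (x, -y x) ∈ P := by
        change y _ = 0
        rw [hyΦ _ hm]; simp
      have h1 := hneg hm
      simp only [neg_neg] at h1
      refine ⟨(Φ (x, -y x), y x), ⟨hp, by simpa using hxr.le⟩, ?_⟩
      exact congrArg Prod.fst (L.unique (hΦ' _ ⟨_, h1⟩) h1)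
  · rw [Topology.IsInducing.subtypeVal.continuousOn_iff]
    refine ContinuousOn.congr (f := fun x => Φ (x, -y x)) ?_ hρN
    refine hΦc.comp (by fun_prop) ?_
    rintro _ ⟨a, ha, rfl⟩
    exact (hback a ha).1
  · rintro _ ⟨a, ha, rfl⟩ _ ⟨b, hb, rfl⟩ hab
    simp only [Prod.mk.injEq] at hab
    have h1 : a.2 = b.2 := by rw [← (hback a ha).2.2, ← (hback b hb).2.2, hab.1]
    have h2 : a.1 = b.1 := by rw [← hρ' a ha, ← hρ' b hb, hab.2]
    rw [Prod.ext h2 h1]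
  · intro c hc p
    have ha : ((p : X), c) ∈ P ×ˢ Metric.closedBall (0 : E) r := ⟨p.2, by simpa using hc⟩
    exact ⟨_, ⟨_, ha, rfl⟩, (hback _ ha).2.2, Subtype.ext (hρ' _ ha)⟩

end Topological
end LocalFlow
end GVF

/-! ### The backward clock and the coordinates on the basin -/

namespace GVF
namespace LocalFlow

variable {X : Type*} [EMetricSpace X] {L : LocalFlow X}

variable (L) in
/-- The set of pairs `(x, t)` such that the local flow reaches `x` from some point within the time
`t`, together with all pairs with `t < 0`. -/
def backwardDomain : Set (X × ℝ) := {p | 0 ≤ p.2 → ∃ x, L.rel p.2 x p.1}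

/-- For `t ≥ 0` this is `cont_rev`; including all negative times keeps the set open at `t = 0`. -/
theorem isOpen_backwardDomain : IsOpen L.backwardDomain := by
  rw [isOpen_iff_mem_nhds]
  rintro ⟨s, t⟩ h
  rcases lt_or_ge t 0 with ht | ht
  · filter_upwards [continuous_snd.continuousAt.eventually (gt_mem_nhds ht)] with p hp h0
    exact absurd h0 (not_le.2 hp)
  · obtain ⟨x, hx⟩ := h ht
    have h2 : Tendsto (fun p : X × ℝ => (p.2, p.1)) (𝓝 (s, t)) (𝓝 (t, s)) :=
      continuous_swap.tendsto _
    filter_upwards [h2.eventually (L.cont_rev hx univ univ_mem)] with p hp h0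
    obtain ⟨x', -, hx'⟩ := hp h0
    exact ⟨x', hx'⟩

variable (L) in
/-- A reparametrization of the backward time that becomes infinite where the local flow cannot be
continued backward. -/
noncomputable def backwardClock (p : X × ℝ) : ℝ≥0∞ :=
  -- The first term gives strict growth and divergence along infinite backward orbits, the second
  -- blows up at the end of finite ones. If the complement is empty, its distance is `⊤` and the
  -- second term is `0`.
  ENNReal.ofReal p.2 + (Metric.infEDist p L.backwardDomainᶜ)⁻¹

theorem continuous_backwardClock : Continuous L.backwardClock :=
  (ENNReal.continuous_ofReal.comp continuous_snd).add
    (continuous_inv.comp Metric.continuous_infEDist)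

theorem backwardClock_lt_top {p : X × ℝ} : L.backwardClock p < ⊤ ↔ p ∈ L.backwardDomain := by
  rw [backwardClock, ENNReal.add_lt_top, ENNReal.inv_lt_top, Metric.infEDist_pos_iff_notMem_closure,
    isOpen_backwardDomain.isClosed_compl.closure_eq]
  simp

/-- A point that cannot be continued backward for a time `u ≥ 0` cannot be continued longer, so the
complement of the domain is mapped into itself by upward time shifts, which are isometries. -/
theorem infEDist_backwardDomain_anti (x : X) {t t' : ℝ} (h : t ≤ t') :
    Metric.infEDist (x, t') L.backwardDomainᶜ ≤ Metric.infEDist (x, t) L.backwardDomainᶜ := by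
  rw [Metric.le_infEDist]
  rintro ⟨s, u⟩ hs
  have hs' : (s, u + (t' - t)) ∈ L.backwardDomainᶜ := by
    intro hc
    refine hs fun hu => ?_
    obtain ⟨z, hz⟩ := hc (by dsimp only; linarith [show (0 : ℝ) ≤ u from hu])
    obtain ⟨w, -, hw⟩ := L.split hz (sub_nonneg.2 h) (by
      dsimp only; linarith [show (0 : ℝ) ≤ u from hu])
    exact ⟨w, by simpa using hw⟩
  refine (Metric.infEDist_le_edist_of_mem hs').trans (le_of_eq ?_)
  have h1 : edist t' (u + (t' - t)) = edist t u := by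
    rw [edist_dist, edist_dist, Real.dist_eq, Real.dist_eq]; congr 2; ring
  rw [Prod.edist_eq, Prod.edist_eq, h1]

theorem backwardClock_strictMono {x : X} {t t' : ℝ} (ht : 0 ≤ t) (htt' : t < t')
    (hx : (x, t) ∈ L.backwardDomain) : L.backwardClock (x, t) < L.backwardClock (x, t') := by
  refine ENNReal.add_lt_add_of_lt_of_le ?_ ?_ ?_
  · have := backwardClock_lt_top.2 hx
    rw [backwardClock, ENNReal.add_lt_top] at this
    exact this.2.ne
  · exact (ENNReal.ofReal_lt_ofReal_iff (ht.trans_lt htt')).2 htt'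
  · exact ENNReal.inv_le_inv.2 (infEDist_backwardDomain_anti x htt'.le)

theorem le_backwardClock (p : X × ℝ) : ENNReal.ofReal p.2 ≤ L.backwardClock p := le_self_add

theorem mem_backwardDomain {t : ℝ} {x s : X} (h : L.rel t x s) : (s, t) ∈ L.backwardDomain :=
  fun _ => ⟨x, h⟩

theorem backwardClock_zero_le {t : ℝ} {x s : X} (h : L.rel t x s) :
    L.backwardClock (s, 0) ≤ L.backwardClock (s, t) := by
  rcases (L.nonneg h).eq_or_lt with rfl | ht
  · exact le_rfl
  · refine (backwardClock_strictMono le_rfl ht ?_).le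
    obtain ⟨w, -, hw⟩ := L.split h (L.nonneg h) le_rfl
    exact mem_backwardDomain (x := w) (by simpa using hw)

variable (L) in
open Classical in
/-- The point from which the local flow reaches a given point within a given time. -/
noncomputable def backwardPoint (p : X × ℝ) : X :=
  if h : ∃ x, L.rel p.2 x p.1 then h.choose else p.1

theorem backwardPoint_eq {t : ℝ} {x s : X} (h : L.rel t x s) : L.backwardPoint (s, t) = x := by
  have h' : ∃ x, L.rel t x s := ⟨x, h⟩
  rw [backwardPoint, dif_pos h']
  exact L.injective h'.choose_spec h

theorem continuousOn_backwardPoint :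
    ContinuousOn L.backwardPoint {p | 0 ≤ p.2 ∧ p ∈ L.backwardDomain} := by
  rintro ⟨s, t⟩ ⟨h0, hp⟩ W hW
  obtain ⟨x, hx⟩ := hp h0
  rw [backwardPoint_eq hx] at hW
  have h2 : Tendsto (fun p : X × ℝ => (p.2, p.1)) (𝓝 (s, t)) (𝓝 (t, s)) :=
    continuous_swap.tendsto _
  rw [mem_map]
  filter_upwards [nhdsWithin_le_nhds (h2.eventually (L.cont_rev hx W hW)),
    self_mem_nhdsWithin] with p hp hp'
  obtain ⟨x', hx', hr⟩ := hp hp'.1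
  rw [← backwardPoint_eq hr] at hx'
  exact hx'

namespace IsTrap

variable {E : Type*} [NormedAddCommGroup E] {N : Set X} {y : X → E} {r : ℝ}

theorem clock_zero_lt_top (hN : L.IsTrap N y r) {x : X} (hx : x ∈ N) :
    L.backwardClock (x, 0) < ⊤ := backwardClock_lt_top.2 (mem_backwardDomain (hN.refl hx))

theorem clock_hit_lt_top (hN : L.IsTrap N y r) {x : X} (hx : x ∈ L.basin N) :
    L.backwardClock (L.hitPoint N x, L.hitTime N x) < ⊤ :=
  backwardClock_lt_top.2 (mem_backwardDomain (hN.rel_hit hx))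

variable (L N) in
/-- The reparametrized time that a point of the basin of `N` takes to enter `N`. -/
noncomputable def height (x : X) : ℝ :=
  (L.backwardClock (L.hitPoint N x, L.hitTime N x)).toReal -
    (L.backwardClock (L.hitPoint N x, 0)).toReal

theorem height_nonneg (hN : L.IsTrap N y r) {x : X} (hx : x ∈ L.basin N) : 0 ≤ height L N x :=
  sub_nonneg.2 <| ENNReal.toReal_mono (hN.clock_hit_lt_top hx).ne
    (backwardClock_zero_le (hN.rel_hit hx))

theorem height_eq_zero {x : X} (h : L.hitTime N x = 0) : height L N x = 0 := by
  rw [height, h, sub_self]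

theorem height_pos (hN : L.IsTrap N y r) {x : X} (hx : x ∈ L.basin N) (h : 0 < L.hitTime N x) :
    0 < height L N x :=
  sub_pos.2 <| (ENNReal.toReal_lt_toReal (hN.clock_zero_lt_top (hN.hitPoint_mem hx)).ne
    (hN.clock_hit_lt_top hx).ne).2 <| backwardClock_strictMono le_rfl h
      (mem_backwardDomain (hN.refl (hN.hitPoint_mem hx)))

theorem continuous_height (hN : L.IsTrap N y r) :
    Continuous fun x : L.basin N => height L N x := by
  refine Continuous.sub ?_ ?_
  · refine continuous_iff_continuousAt.2 fun x => ?_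
    refine (ENNReal.tendsto_toReal (hN.clock_hit_lt_top x.2).ne).comp ?_
    exact (continuous_backwardClock.comp
      (hN.continuous_hitPoint.prodMk hN.continuous_hitTime)).continuousAt
  · refine continuous_iff_continuousAt.2 fun x => ?_
    refine (ENNReal.tendsto_toReal (hN.clock_zero_lt_top (hN.hitPoint_mem x.2)).ne).comp ?_
    exact (continuous_backwardClock.comp
      (hN.continuous_hitPoint.prodMk continuous_const)).continuousAt

variable [NormedSpace ℝ E] {T : Type*} {θ : X → T}

variable (L N y) in
/-- The coordinates on the basin of `N` that extend the coordinates `(y, θ)` on `N`. -/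
noncomputable def coord (θ : X → T) (x : X) : E × T :=
  ((1 + height L N x) • y (L.hitPoint N x), θ (L.hitPoint N x))

theorem norm_coord_le (hN : L.IsTrap N y r) {x : X} (hx : x ∈ L.basin N)
    (h : L.hitTime N x = 0) : ‖(coord L N y θ x).1‖ ≤ r := by
  simpa [coord, height_eq_zero h] using hN.norm_le _ (hN.hitPoint_mem hx)

theorem norm_coord_eq (hN : L.IsTrap N y r) {x : X} (hx : x ∈ L.basin N)
    (h : 0 < L.hitTime N x) : ‖(coord L N y θ x).1‖ = (1 + height L N x) * r := by
  rw [coord, norm_smul, hN.norm_hitPoint hx h, Real.norm_of_nonneg]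
  linarith [hN.height_nonneg hx]

theorem lt_norm_coord (hN : L.IsTrap N y r) (hr : 0 < r) {x : X} (hx : x ∈ L.basin N)
    (h : 0 < L.hitTime N x) : r < ‖(coord L N y θ x).1‖ := by
  rw [hN.norm_coord_eq hx h]
  nlinarith [hN.height_pos hx h]

/-- The norm of the first coordinate exceeds `r` exactly for points outside `N`, and there it
determines the height. Dividing by `1 + height` recovers the coordinates of the entry point, strict
monotonicity of the clock recovers the entry time, and injectivity of the flow recovers the point.
-/
theorem coord_injOn (hN : L.IsTrap N y r) (hr : 0 < r)
    (hinj : InjOn (fun x => (y x, θ x)) N) : InjOn (coord L N y θ) (L.basin N) := by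
  intro x hx x' hx' h
  have key : L.hitTime N x = L.hitTime N x' ∧ y (L.hitPoint N x) = y (L.hitPoint N x') ∨
      0 < L.hitTime N x ∧ 0 < L.hitTime N x' ∧ height L N x = height L N x' ∧
        y (L.hitPoint N x) = y (L.hitPoint N x') := by
    rcases (hN.hitTime_nonneg hx).eq_or_lt with h0 | h0 <;>
      rcases (hN.hitTime_nonneg hx').eq_or_lt with h0' | h0'
    · refine Or.inl ⟨h0.symm.trans h0', ?_⟩
      simpa [coord, height_eq_zero h0.symm, height_eq_zero h0'.symm] using congrArg Prod.fst h
    · have h1 := hN.norm_coord_le (θ := θ) hx h0.symm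
      rw [h] at h1
      exact absurd h1 (not_le.2 (hN.lt_norm_coord hr hx' h0'))
    · have h1 := hN.norm_coord_le (θ := θ) hx' h0'.symm
      rw [← h] at h1
      exact absurd h1 (not_le.2 (hN.lt_norm_coord hr hx h0))
    · have h1 := hN.norm_coord_eq (θ := θ) hx h0
      rw [h, hN.norm_coord_eq hx' h0'] at h1
      have h2 : height L N x = height L N x' := by
        have := mul_right_cancel₀ hr.ne' h1
        linarith
      refine Or.inr ⟨h0, h0', h2, ?_⟩
      have h3 := congrArg Prod.fst h
      simp only [coord, h2] at h3
      exact smul_right_injective E (by linarith [hN.height_nonneg hx'] : 1 + height L N x' ≠ 0 ) h3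
  have hy : y (L.hitPoint N x) = y (L.hitPoint N x') := by
    rcases key with h | h
    exacts [h.2, h.2.2.2]
  have hp : L.hitPoint N x = L.hitPoint N x' :=
    hinj (hN.hitPoint_mem hx) (hN.hitPoint_mem hx') (Prod.ext hy (congrArg Prod.snd h :))
  have ht : L.hitTime N x = L.hitTime N x' := by
    rcases key with h | ⟨h0, h0', hh, -⟩
    · exact h.1
    have hc : L.backwardClock (L.hitPoint N x, L.hitTime N x) =
        L.backwardClock (L.hitPoint N x, L.hitTime N x') := by
      rw [← ENNReal.toReal_eq_toReal_iff' (hN.clock_hit_lt_top hx).ne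
        (hp ▸ (hN.clock_hit_lt_top hx').ne)]
      have : height L N x = height L N x' := hh
      simp only [height, hp] at this ⊢
      linarith
    rcases lt_trichotomy (L.hitTime N x) (L.hitTime N x') with hlt | heq | hlt
    · exact absurd hc (backwardClock_strictMono h0.le hlt
        (mem_backwardDomain (hN.rel_hit hx))).ne
    · exact heq
    · exact absurd hc (backwardClock_strictMono h0'.le hlt
        (mem_backwardDomain (hp ▸ hN.rel_hit hx'))).ne'
  have h1 := hN.rel_hit hx
  rw [hp, ht] at h1
  exact L.injective h1 (hN.rel_hit hx')

theorem coord_surjOn (hN : L.IsTrap N y r) (hr : 0 < r)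
    (hsurj : ∀ c, ‖c‖ ≤ r → ∀ q, ∃ x ∈ N, y x = c ∧ θ x = q) (p : E × T) :
    ∃ x ∈ L.basin N, coord L N y θ x = p := by
  obtain ⟨z, q⟩ := p
  rcases le_or_gt ‖z‖ r with hz | hz
  · obtain ⟨x, hx, rfl, rfl⟩ := hsurj z hz q
    obtain ⟨h1, h2⟩ := hN.hit_eq (hN.refl hx) hx (Or.inl rfl)
    exact ⟨x, hN.subset_basin hx, by simp [coord, height_eq_zero h1, h2]⟩
  · have hz0 : 0 < ‖z‖ := hr.trans hz
    have hc : ‖(r / ‖z‖) • z‖ = r := by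
      rw [norm_smul, Real.norm_of_nonneg (by positivity), div_mul_cancel₀ _ hz0.ne']
    obtain ⟨s, hs, hys, rfl⟩ := hsurj ((r / ‖z‖) • z) hc.le q
    set u : ℝ := ‖z‖ / r - 1 with hu
    have hu0 : 0 < u := by rw [hu, sub_pos, one_lt_div hr]; exact hz
    have hlt := hN.clock_zero_lt_top hs
    set a := (L.backwardClock (s, 0)).toReal with ha
    have ha' : L.backwardClock (s, 0) = ENNReal.ofReal a := (ENNReal.ofReal_toReal hlt.ne).symm
    have ha0 : 0 ≤ a := ENNReal.toReal_nonneg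
    -- The clock starts at `a` and is at least `a + u` at `t = a + u`, possibly infinite. The
    -- intermediate value theorem in `ℝ≥0∞` gives the finite value `a + u`, and finiteness
    -- guarantees that the backward orbit exists.
    have hcont : ContinuousOn (fun t : ℝ => L.backwardClock (s, t)) (Icc 0 (a + u)) :=
      (continuous_backwardClock.comp (Continuous.prodMk_right s)).continuousOn
    obtain ⟨t, ht, hta⟩ := intermediate_value_Icc (add_nonneg ha0 hu0.le) hcont
      (show ENNReal.ofReal (a + u) ∈ Icc (L.backwardClock (s, 0)) (L.backwardClock (s, a + u)) from
        ⟨ha' ▸ ENNReal.ofReal_le_ofReal (by linarith), le_backwardClock _⟩)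
    dsimp only at hta
    have hmem : (s, t) ∈ L.backwardDomain := backwardClock_lt_top.1 (hta ▸ ENNReal.ofReal_lt_top)
    obtain ⟨x, hx⟩ := hmem ht.1
    obtain ⟨h1, h2⟩ := hN.hit_eq hx hs (Or.inr (by rw [hys, hc]))
    refine ⟨x, ⟨t, s, hx, hs⟩, ?_⟩
    have hh : height L N x = u := by
      rw [height, h1, h2, hta, ENNReal.toReal_ofReal (by linarith)]; ring
    rw [coord, hh, h2, hys, smul_smul]
    congr 1
    rw [hu, add_sub_cancel, div_mul_div_cancel₀ hr.ne', div_self hz0.ne', one_smul]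

/-- Properness of the coordinates: a bound on the clock bounds the backward time and keeps it away
from the end of the backward orbit, uniformly over the compact set of entry points. -/
theorem isCompact_coord_le (hN : L.IsTrap N y r) (hr : 0 < r) (R : ℝ) :
    ∃ K, IsCompact K ∧ K ⊆ L.basin N ∧ ∀ x ∈ L.basin N, ‖(coord L N y θ x).1‖ ≤ R → x ∈ K := by
  obtain ⟨B, hB⟩ : ∃ B : ℝ, ∀ s ∈ N, L.backwardClock (s, 0) ≤ ENNReal.ofReal B := by
    rcases N.eq_empty_or_nonempty with h | h
    · exact ⟨0, by simp [h]⟩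
    · obtain ⟨s, hs, hmax⟩ := hN.isCompact.exists_isMaxOn h
        (continuous_backwardClock (L := L) |>.comp (Continuous.prodMk_left 0)).continuousOn
      refine ⟨(L.backwardClock (s, 0)).toReal, fun s' hs' => ?_⟩
      rw [ENNReal.ofReal_toReal (hN.clock_zero_lt_top hs).ne]
      exact hmax hs'
  -- A bound for the height: it is at most `R / r - 1` outside `N` and `0` inside.
  set c : ℝ := max (R / r) 1
  set Q : Set (X × ℝ) := {p | p.1 ∈ N ∧ 0 ≤ p.2 ∧
    L.backwardClock p ≤ L.backwardClock (p.1, 0) + ENNReal.ofReal c} with hQ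
  have hQ' : ∀ p ∈ Q, L.backwardClock p ≤ ENNReal.ofReal B + ENNReal.ofReal c := fun p hp =>
    hp.2.2.trans (by gcongr; exact hB _ hp.1)
  have hQdom : Q ⊆ {p | 0 ≤ p.2 ∧ p ∈ L.backwardDomain} := fun p hp =>
    ⟨hp.2.1, backwardClock_lt_top.1 ((hQ' p hp).trans_lt (by simp))⟩
  have hQcl : IsClosed Q := by
    refine (hN.isClosed.preimage continuous_fst).inter (.inter ?_ ?_)
    · exact isClosed_le continuous_const continuous_snd
    · exact isClosed_le continuous_backwardClock ((continuous_backwardClock.comp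
        (continuous_fst.prodMk continuous_const)).add continuous_const)
  have hQc : IsCompact Q := by
    refine (hN.isCompact.prod (isCompact_Icc (a := (0 : ℝ)) (b := max B 0 + c))).of_isClosed_subset
      hQcl fun p hp => ⟨hp.1, hp.2.1, ?_⟩
    have hc0 : 0 ≤ c := zero_le_one.trans (le_max_right _ _)
    have h1 := (le_backwardClock p).trans (hQ' p hp)
    have h2 : ENNReal.ofReal B ≤ ENNReal.ofReal (max B 0) := ENNReal.ofReal_le_ofReal (le_max_left _ _)
    have h3 : ENNReal.ofReal p.2 ≤ ENNReal.ofReal (max B 0 + c) := by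
      rw [ENNReal.ofReal_add (le_max_right _ _) hc0]
      exact h1.trans (by gcongr)
    exact (ENNReal.ofReal_le_ofReal_iff (add_nonneg (le_max_right _ _) hc0)).1 h3
  refine ⟨L.backwardPoint '' Q, hQc.image_of_continuousOn
    (continuousOn_backwardPoint.mono hQdom), ?_, ?_⟩
  · rintro _ ⟨⟨s, t⟩, hp, rfl⟩
    obtain ⟨x, hx⟩ := (hQdom hp).2 hp.2.1
    rw [backwardPoint_eq hx]
    exact ⟨t, s, hx, hp.1⟩
  · intro x hx hR
    refine ⟨(L.hitPoint N x, L.hitTime N x), ⟨hN.hitPoint_mem hx, hN.hitTime_nonneg hx, ?_⟩,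
      backwardPoint_eq (hN.rel_hit hx)⟩
    have hh : height L N x ≤ c := by
      rcases (hN.hitTime_nonneg hx).eq_or_lt with h0 | h0
      · rw [height_eq_zero h0.symm]
        exact zero_le_one.trans (le_max_right _ _)
      · rw [hN.norm_coord_eq hx h0] at hR
        have : 1 + height L N x ≤ R / r := (le_div_iff₀ hr).2 hR
        exact le_trans (by linarith) (le_max_left _ _)
    dsimp only
    have hz := (hN.clock_zero_lt_top (hN.hitPoint_mem hx)).ne
    rw [← ENNReal.ofReal_toReal (hN.clock_hit_lt_top hx).ne, ← ENNReal.ofReal_toReal hz,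
      ← ENNReal.ofReal_add ENNReal.toReal_nonneg (zero_le_one.trans (le_max_right _ _))]
    refine ENNReal.ofReal_le_ofReal ?_
    rw [height] at hh
    linarith

/-- The basin of a trapping region `N` that is homeomorphic to the product of a closed ball and a
space `T` is homeomorphic to the product of the whole vector space and `T`. -/
theorem nonempty_homeomorph [ProperSpace E] [TopologicalSpace T] [CompactSpace T] [T2Space T]
    (hN : L.IsTrap N y r) (hr : 0 < r)
    (hθ : ContinuousOn θ N) (hinj : InjOn (fun x => (y x, θ x)) N)
    (hsurj : ∀ c, ‖c‖ ≤ r → ∀ q, ∃ x ∈ N, y x = c ∧ θ x = q) :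
    Nonempty (L.basin N ≃ₜ E × T) := by
  set F : L.basin N → E × T := fun x => coord L N y θ x with hF
  have hp : ∀ x : L.basin N, L.hitPoint N x ∈ N := fun x => hN.hitPoint_mem x.2
  have hcont : Continuous F :=
    ((continuous_const.add hN.continuous_height).smul
      (hN.continuousOn.comp_continuous hN.continuous_hitPoint hp)).prodMk
      (hθ.comp_continuous hN.continuous_hitPoint hp)
  have hbij : Function.Bijective F := by
    refine ⟨fun x x' h => Subtype.ext (hN.coord_injOn hr hinj x.2 x'.2 h), fun p => ?_⟩
    obtain ⟨x, hx, h⟩ := hN.coord_surjOn hr hsurj p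
    exact ⟨⟨x, hx⟩, h⟩
  -- Properness makes the bijection closed, so its inverse is continuous without an explicit
  -- formula.
  have hproper : IsProperMap F := by
    rw [isProperMap_iff_isCompact_preimage]
    refine ⟨hcont, fun K hK => ?_⟩
    obtain ⟨R, hR⟩ := (hK.image continuous_fst).isBounded.exists_norm_le
    obtain ⟨C, hC, hCb, hCm⟩ := hN.isCompact_coord_le (θ := θ) hr R
    have hC' : IsCompact ((↑) ⁻¹' C : Set (L.basin N)) := by
      rw [Subtype.isCompact_iff, Subtype.image_preimage_coe]
      rwa [inter_eq_right.2 hCb]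
    refine hC'.of_isClosed_subset (hK.isClosed.preimage hcont) fun x hx => ?_
    exact hCm x x.2 (hR _ ⟨_, hx, rfl⟩)
  exact ⟨(Equiv.ofBijective F hbij).toHomeomorphOfContinuousClosed hcont hproper.isClosedMap⟩

end IsTrap
end LocalFlow
end GVF

/-! ### Gluing integral curves and local flow boxes -/

namespace GVF

section FlowBox

variable {E : Type*} [NormedAddCommGroup E] [NormedSpace ℝ E]
  {H : Type*} [TopologicalSpace H] {I : ModelWithCorners ℝ E H}
  {M : Type*} [TopologicalSpace M] [ChartedSpace H M]
  {v : ∀ x : M, TangentSpace I x}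

/-- Two integral curves that fit together form an integral curve. -/
theorem isMIntegralCurveOn_ite {γ₁ γ₂ : ℝ → M} {a b c : ℝ}
    (h₁ : IsMIntegralCurveOn γ₁ v (Icc a b)) (h₂ : IsMIntegralCurveOn γ₂ v (Icc b c))
    (hab : a ≤ b) (hbc : b ≤ c) (h : γ₁ b = γ₂ b) :
    IsMIntegralCurveOn (fun t => if t ≤ b then γ₁ t else γ₂ t) v (Icc a c) := by
  set γ : ℝ → M := fun t => if t ≤ b then γ₁ t else γ₂ t with hγ
  have e₁ : ∀ t ≤ b, γ t = γ₁ t := fun t ht => if_pos ht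
  have e₂ : ∀ t, b ≤ t → γ t = γ₂ t := by
    intro t ht
    rcases ht.eq_or_lt with rfl | ht
    · rw [e₁ _ le_rfl, h]
    · exact if_neg (not_le.2 ht)
  have k₁ : ∀ t ∈ Icc a b, HasMFDerivWithinAt 𝓘(ℝ, ℝ) I γ (Icc a b) t
      ((1 : ℝ →L[ℝ] ℝ).smulRight (v (γ t))) := by
    intro t ht
    rw [e₁ t ht.2]
    exact (h₁ t ht).congr_of_eventuallyEq (eventually_of_mem self_mem_nhdsWithin
      fun s hs => e₁ s hs.2) (e₁ t ht.2)
  have k₂ : ∀ t ∈ Icc b c, HasMFDerivWithinAt 𝓘(ℝ, ℝ) I γ (Icc b c) t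
      ((1 : ℝ →L[ℝ] ℝ).smulRight (v (γ t))) := by
    intro t ht
    rw [e₂ t ht.1]
    exact (h₂ t ht).congr_of_eventuallyEq (eventually_of_mem self_mem_nhdsWithin
      fun s hs => e₂ s hs.1) (e₂ t ht.1)
  intro t ht
  rcases lt_trichotomy t b with htb | rfl | htb
  · refine (k₁ t ⟨ht.1, htb.le⟩).mono_of_mem_nhdsWithin ?_
    filter_upwards [self_mem_nhdsWithin, nhdsWithin_le_nhds (gt_mem_nhds htb)] with s hs hsb
      using ⟨hs.1, le_of_lt hsb⟩
  · have := (k₁ t ⟨ht.1, le_rfl⟩).union (k₂ t ⟨le_rfl, ht.2⟩)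
    rwa [Icc_union_Icc_eq_Icc hab hbc] at this
  · refine (k₂ t ⟨htb.le, ht.2⟩).mono_of_mem_nhdsWithin ?_
    filter_upwards [self_mem_nhdsWithin, nhdsWithin_le_nhds (lt_mem_nhds htb)] with s hs hsb
      using ⟨le_of_lt hsb, hs.2⟩

/-- A curve that solves the differential equation in a chart is an integral curve. -/
theorem hasMFDerivWithinAt_extChartAt_symm_comp [IsManifold I 1 M] {x₀ : M} {f : ℝ → E}
    {s : Set ℝ} {t : ℝ} (hf : f t ∈ interior (extChartAt I x₀).target)
    (h : HasDerivWithinAt f (tangentCoordChange I ((extChartAt I x₀).symm (f t)) x₀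
      ((extChartAt I x₀).symm (f t)) (v ((extChartAt I x₀).symm (f t)))) s t) :
    HasMFDerivWithinAt 𝓘(ℝ, ℝ) I ((extChartAt I x₀).symm ∘ f) s t
      ((1 : ℝ →L[ℝ] ℝ).smulRight (v (((extChartAt I x₀).symm ∘ f) t))) := by
  set xₜ : M := (extChartAt I x₀).symm (f t) with hxt
  have hf3' := mem_of_mem_of_subset hf interior_subset
  have hft1 := mem_preimage.mp <|
    mem_of_mem_of_subset hf3' (extChartAt I x₀).target_subset_preimage_source
  have hft2 := mem_extChartAt_source (I := I) xₜ
  have key : ∀ w : E, HasDerivWithinAt f (tangentCoordChange I xₜ x₀ xₜ w) s t →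
      HasFDerivWithinAt ((extChartAt I xₜ ∘ (extChartAt I x₀).symm) ∘ f)
        ((1 : ℝ →L[ℝ] ℝ).smulRight w) s t := by
    intro w h
    have h1 : (1 : ℝ →L[ℝ] ℝ).smulRight w = ContinuousLinearMap.toSpanSingleton ℝ w := by
      ext; simp
    rw [h1]
    apply HasDerivWithinAt.hasFDerivWithinAt
    -- Write `w` as the image, under the derivative of the chart transition, of its coordinates in
    -- the chart at `x₀`; then the chain rule applies.
    rw [← tangentCoordChange_self (I := I) (x := xₜ) (z := xₜ) (v := w) hft2,
      ← tangentCoordChange_comp (x := x₀) ⟨⟨hft2, hft1⟩, hft2⟩]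
    apply HasFDerivAt.comp_hasDerivWithinAt _ _ h
    apply HasFDerivWithinAt.hasFDerivAt (s := range I) _ <|
      mem_nhds_iff.mpr ⟨interior (extChartAt I x₀).target,
        subset_trans interior_subset (extChartAt_target_subset_range ..),
        isOpen_interior, hf⟩
    rw [← (extChartAt I x₀).right_inv hf3']
    exact hasFDerivWithinAt_tangentCoordChange ⟨hft1, hft2⟩
  refine ⟨(continuousAt_extChartAt_symm'' hf3').comp_continuousWithinAt h.continuousWithinAt, ?_⟩
  have hs : (extChartAt 𝓘(ℝ, ℝ) t).symm ⁻¹' s ∩ range 𝓘(ℝ, ℝ) = s := by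
    rw [extChartAt_model_space_eq_id]; simp
  rw [hs]
  exact key _ h

/-- The vector field `v` has a continuous flow with values in `O`, up to the time `s`, near `x`. -/
def HasFlowNear (v : ∀ x : M, TangentSpace I x) (O : Set M) (x : M) (s : ℝ) : Prop :=
  ∃ U ∈ 𝓝 x, ∃ F : M → ℝ → M, ContinuousOn (Function.uncurry F) (U ×ˢ Icc 0 s) ∧
    ∀ x' ∈ U, F x' 0 = x' ∧ IsMIntegralCurveOn (F x') v (Icc 0 s) ∧ MapsTo (F x') (Icc 0 s) O

/-- A continuously differentiable vector field has a local flow. -/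
theorem exists_hasFlowNear [CompleteSpace E] [BoundarylessManifold I M] [IsManifold I 1 M]
    {O : Set M} {x₀ : M} (hO : O ∈ 𝓝 x₀)
    (hv : ContMDiffAt I I.tangent 1 (fun x => (⟨x, v x⟩ : TangentBundle I M)) x₀) :
    ∃ ε > 0, HasFlowNear v O x₀ ε := by
  have hx := BoundarylessManifold.isInteriorPoint (I := I) (x := x₀)
  rw [contMDiffAt_iff] at hv
  obtain ⟨-, hv⟩ := hv
  set e := extChartAt I x₀ with he
  obtain ⟨ε, hε, a, r, L, K, hr, hPL⟩ := IsPicardLindelof.of_contDiffAt_one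
    (hv.contDiffAt (range_mem_nhds_isInteriorPoint hx)).snd
  obtain ⟨α, hα, hαc⟩ :=
    (hPL 0).exists_forall_mem_closedBall_eq_hasDerivWithinAt_continuousOn
  have hopen : interior e.target ∩ e.symm ⁻¹' O ∈ 𝓝 (e x₀) := by
    refine inter_mem (isOpen_interior.mem_nhds ((I.isInteriorPoint_iff).mp hx)) ?_
    refine (continuousAt_extChartAt_symm x₀).preimage_mem_nhds ?_
    rwa [extChartAt_to_inv]
  have hm0 : ((e x₀, 0) : E × ℝ) ∈ Metric.closedBall (e x₀) r ×ˢ Icc (0 - ε) (0 + ε) :=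
    ⟨Metric.mem_closedBall_self r.2, by constructor <;> linarith⟩
  have hα0 : α (e x₀, 0) = e x₀ := (hα _ hm0.1).1
  -- Continuity of the Picard–Lindelöf solution in both variables gives a common time during which
  -- all nearby solutions stay in the chart and in `O`.
  have hnear : ∀ᶠ p : E × ℝ in 𝓝 (e x₀, 0), α p ∈ interior e.target ∩ e.symm ⁻¹' O ∧
      p ∈ Metric.closedBall (e x₀) r ×ˢ Icc (0 - ε) (0 + ε) := by
    have hnh : Metric.closedBall (e x₀) r ×ˢ Icc (0 - ε) (0 + ε) ∈ 𝓝 ((e x₀, 0) : E × ℝ) :=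
      prod_mem_nhds (Metric.closedBall_mem_nhds _ hr) (Icc_mem_nhds (by linarith) (by linarith))
    have h1 := (hαc.continuousAt hnh).preimage_mem_nhds (hα0.symm ▸ hopen)
    exact inter_mem h1 hnh
  obtain ⟨U', hU', V', hV', hUV⟩ := mem_nhds_prod_iff.1 hnear
  obtain ⟨δ, hδ, hδV⟩ := Metric.nhds_basis_closedBall.mem_iff.1 hV'
  have hV'' : Icc 0 δ ⊆ V' := fun t ht => hδV (by
    rw [Metric.mem_closedBall, Real.dist_eq, sub_zero, abs_of_nonneg ht.1]; exact ht.2)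
  refine ⟨δ, hδ, e.source ∩ e ⁻¹' U', inter_mem (extChartAt_source_mem_nhds x₀)
    ((continuousAt_extChartAt x₀).preimage_mem_nhds hU'), fun x t => e.symm (α (e x, t)), ?_, ?_⟩
  · have h1 : ContinuousOn (fun p : M × ℝ => α (e p.1, p.2))
        ((e.source ∩ e ⁻¹' U') ×ˢ Icc 0 δ) := by
      refine hαc.comp ?_ fun p hp => (hUV (mk_mem_prod hp.1.2 (hV'' hp.2))).2
      exact ((continuousOn_extChartAt x₀).comp continuousOn_fst fun p hp => hp.1.1).prodMk
        continuousOn_snd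
    exact (continuousOn_extChartAt_symm x₀).comp h1 fun p hp =>
      interior_subset (hUV (mk_mem_prod hp.1.2 (hV'' hp.2))).1.1
  · rintro x ⟨hxs, hxU⟩
    have hxm : ∀ t ∈ Icc 0 δ, α (e x, t) ∈ interior e.target ∩ e.symm ⁻¹' O ∧
      (e x, t) ∈ Metric.closedBall (e x₀) r ×ˢ Icc (0 - ε) (0 + ε) :=
        fun t ht => hUV (mk_mem_prod hxU (hV'' ht))
    have hx0 := (hxm 0 ⟨le_rfl, hδ.le⟩).2
    refine ⟨(congrArg e.symm (hα _ hx0.1).1).trans (e.left_inv hxs), fun t ht => ?_, fun t ht => (hxm t ht).1.2⟩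
    refine hasMFDerivWithinAt_extChartAt_symm_comp (f := fun t => α (e x, t)) (hxm t ht).1.1 ?_
    have h2 := ((hα _ hx0.1).2 t (hxm t ht).2.2).mono
      (show Icc 0 δ ⊆ Icc (0 - ε) (0 + ε) from fun s hs => (hxm s hs).2.2)
    exact h2

end FlowBox
end GVF

/-! ### The local flow of a continuously differentiable vector field -/

namespace GVF

section FlowRel

variable {E : Type*} [NormedAddCommGroup E] [NormedSpace ℝ E]
  {H : Type*} [TopologicalSpace H] {I : ModelWithCorners ℝ E H}
  {M : Type*} [TopologicalSpace M] [ChartedSpace H M]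
  {v : ∀ x : M, TangentSpace I x} {O : Set M}

/-- Some integral curve of `v` inside `O` leads from `x` to `y` within the time `t`. -/
def FlowRel (v : ∀ x : M, TangentSpace I x) (O : Set M) (t : ℝ) (x y : M) : Prop :=
  0 ≤ t ∧ ∃ γ : ℝ → M, γ 0 = x ∧ γ t = y ∧ IsMIntegralCurveOn γ v (Icc 0 t) ∧
    MapsTo γ (Icc 0 t) O

theorem isMIntegralCurveOn_shift {γ : ℝ → M} {a b c : ℝ} (h : IsMIntegralCurveOn γ v (Icc a b)) :
    IsMIntegralCurveOn (fun t => γ (t + c)) v (Icc (a - c) (b - c)) := by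
  refine (h.comp_add c).mono fun t ht => ?_
  exact ⟨by linarith [ht.1], by linarith [ht.2]⟩

theorem FlowRel.trans {s t : ℝ} {x y z : M} (h₁ : FlowRel v O s x y) (h₂ : FlowRel v O t y z) :
    FlowRel v O (s + t) x z := by
  obtain ⟨hs, γ₁, h10, h1s, hi1, hm1⟩ := h₁
  obtain ⟨ht, γ₂, h20, h2t, hi2, hm2⟩ := h₂
  refine ⟨by linarith, fun u => if u ≤ s then γ₁ u else γ₂ (u - s), ?_, ?_, ?_, ?_⟩
  · simp [hs, h10]
  · rcases ht.eq_or_lt with rfl | ht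
    · simp [h1s, ← h20, h2t]
    · simp [ht, h2t]
  · have h3 := isMIntegralCurveOn_shift (c := -s) hi2
    rw [zero_sub, neg_neg, sub_neg_eq_add, add_comm] at h3
    exact isMIntegralCurveOn_ite hi1 h3 hs (by linarith) (by simp [h1s, h20])
  · intro u hu
    dsimp only
    split_ifs with hus
    · exact hm1 ⟨hu.1, hus⟩
    · exact hm2 ⟨by linarith, by linarith [hu.2]⟩

theorem FlowRel.split {s t : ℝ} {x z : M} (h : FlowRel v O t x z) (hs : 0 ≤ s) (hst : s ≤ t) :
    ∃ y, FlowRel v O s x y ∧ FlowRel v O (t - s) y z := by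
  obtain ⟨ht, γ, h0, h1, hi, hm⟩ := h
  refine ⟨γ s, ⟨hs, γ, h0, rfl, hi.mono (Icc_subset_Icc_right hst),
    hm.mono_left (Icc_subset_Icc_right hst)⟩, sub_nonneg.2 hst, fun u => γ (u + s), by simp,
    by simp [h1], (isMIntegralCurveOn_shift (c := s) hi).mono (Icc_subset_Icc_left (by linarith)),
    fun u hu => hm ⟨by linarith [hu.1], by linarith [hu.2]⟩⟩

/-- Time reversal reduces injectivity and backward continuity of the flow to uniqueness and
continuity for `-v`. -/
theorem FlowRel.reverse {t : ℝ} {x y : M} (h : FlowRel v O t x y) : FlowRel (-v) O t y x := by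
  obtain ⟨ht, γ, h0, h1, hi, hm⟩ := h
  refine ⟨ht, fun u => γ (t - u), by simp [h1], by simp [h0], ?_,
    fun u hu => hm ⟨by linarith [hu.2], by linarith [hu.1]⟩⟩
  have h2 := (hi.comp_add t).comp_mul (-1)
  have h3 : ((fun u => γ (t - u)) : ℝ → M) = (γ ∘ fun x => x + t) ∘ fun x => x * -1 := by
    ext u; simp only [Function.comp_apply]; congr 1; ring
  have h4 : (-v : ∀ x : M, TangentSpace I x) = (-1 : ℝ) • v := by
    ext1 x; simp
  rw [h3, h4]
  refine h2.mono fun u hu => ?_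
  exact ⟨by linarith [hu.2], by linarith [hu.1]⟩

theorem HasFlowNear.mono {x : M} {s t : ℝ} (h : HasFlowNear v O x t) (hst : s ≤ t) :
    HasFlowNear v O x s := by
  obtain ⟨U, hU, F, hFc, hF⟩ := h
  have hsub : Icc 0 s ⊆ Icc 0 t := Icc_subset_Icc_right hst
  exact ⟨U, hU, F, hFc.mono (prod_mono_right hsub), fun x' hx' =>
    ⟨(hF x' hx').1, (hF x' hx').2.1.mono hsub, (hF x' hx').2.2.mono_left hsub⟩⟩

section

variable [CompleteSpace E] [BoundarylessManifold I M] [IsManifold I 1 M]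

/-- Both curves are prolonged to the left of `a` by the same local solution, so that uniqueness for
curves defined on a neighborhood of `a` applies. -/
theorem eventually_eq_of_isMIntegralCurveOn {γ γ' : ℝ → M} {a b : ℝ} (hab : a < b)
    (hv : ContMDiffAt I I.tangent 1 (fun x => (⟨x, v x⟩ : TangentBundle I M)) (γ a))
    (h : IsMIntegralCurveOn γ v (Icc a b)) (h' : IsMIntegralCurveOn γ' v (Icc a b))
    (haa : γ a = γ' a) : ∀ᶠ t in 𝓝[>] a, γ t = γ' t := by
  obtain ⟨β, hβ, hβi⟩ := exists_isMIntegralCurveAt_of_contMDiffAt_boundaryless (t₀ := a) hv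
  obtain ⟨ε, hε, hβi⟩ := isMIntegralCurveAt_iff'.1 hβi
  have hβi' : IsMIntegralCurveOn β v (Icc (a - ε / 2) a) := hβi.mono fun t ht => by
    rw [Metric.mem_ball, Real.dist_eq, abs_lt]
    constructor <;> linarith [ht.1, ht.2]
  have hm : Icc (a - ε / 2) b ∈ 𝓝 a := Icc_mem_nhds (by linarith) hab
  have k := isMIntegralCurveOn_ite hβi' h (by linarith) hab.le hβ
  have k' := isMIntegralCurveOn_ite hβi' h' (by linarith) hab.le (hβ.trans haa)
  have := isMIntegralCurveAt_eventuallyEq_of_contMDiffAt_boundaryless (t₀ := a)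
    (by simpa [hβ] using hv) (k.isMIntegralCurveAt hm) (k'.isMIntegralCurveAt hm) (by simp)
  filter_upwards [nhdsWithin_le_nhds this, self_mem_nhdsWithin] with t ht hta
  simpa [not_le.2 (mem_Ioi.1 hta)] using ht

variable [T2Space M]

theorem eqOn_of_isMIntegralCurveOn
    (hv : ∀ x ∈ O, ContMDiffAt I I.tangent 1 (fun x => (⟨x, v x⟩ : TangentBundle I M)) x)
    {γ γ' : ℝ → M} {a b : ℝ} (h : IsMIntegralCurveOn γ v (Icc a b))
    (h' : IsMIntegralCurveOn γ' v (Icc a b)) (hm : MapsTo γ (Icc a b) O) (haa : γ a = γ' a) :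
    EqOn γ γ' (Icc a b) := by
  have hcl : IsClosed ({t | γ t = γ' t} ∩ Icc a b) := by
    have h1 : ({t | γ t = γ' t} ∩ Icc a b) =
        Icc a b ∩ (fun t => (γ t, γ' t)) ⁻¹' diagonal M := by
      ext t; simp [and_comm]
    rw [h1]
    exact (h.continuousOn.prodMk h'.continuousOn).preimage_isClosed_of_isClosed isClosed_Icc
      isClosed_diagonal
  refine hcl.Icc_subset_of_forall_mem_nhdsWithin haa ?_
  rintro t ⟨hteq, ht⟩
  have hsub : Icc t b ⊆ Icc a b := Icc_subset_Icc_left ht.1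
  exact eventually_eq_of_isMIntegralCurveOn ht.2 (hv _ (hm ⟨ht.1, ht.2.le⟩)) (h.mono hsub)
    (h'.mono hsub) hteq

theorem FlowRel.unique
    (hv : ∀ x ∈ O, ContMDiffAt I I.tangent 1 (fun x => (⟨x, v x⟩ : TangentBundle I M)) x)
    {t : ℝ} {x y y' : M} (h : FlowRel v O t x y) (h' : FlowRel v O t x y') : y = y' := by
  obtain ⟨ht, γ, h0, rfl, hi, hm⟩ := h
  obtain ⟨-, γ', h0', rfl, hi', -⟩ := h'
  exact eqOn_of_isMIntegralCurveOn hv hi hi' hm (h0.trans h0'.symm) ⟨ht, le_rfl⟩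

/-- Follow the first flow until time `s` and then the flow near `y`; uniqueness ensures that the
first flow carries `x` to `y`, hence nearby points close to `y`. -/
theorem HasFlowNear.extend {x : M} {s ε : ℝ} (h : HasFlowNear v O x s) (hs : 0 ≤ s) (hε : 0 ≤ ε)
    {y : M} (hy : FlowRel v O s x y) (h' : HasFlowNear v O y ε)
    (hv : ∀ x ∈ O, ContMDiffAt I I.tangent 1 (fun x => (⟨x, v x⟩ : TangentBundle I M)) x) :
    HasFlowNear v O x (s + ε) := by
  obtain ⟨U, hU, F, hFc, hF⟩ := h
  obtain ⟨V, hV, G, hGc, hG⟩ := h'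
  have hFx := hF x (mem_of_mem_nhds hU)
  have hFy : F x s = y :=
    FlowRel.unique hv ⟨hs, F x, hFx.1, rfl, hFx.2⟩ hy
  have hslice : ContinuousOn (fun x' => F x' s) U :=
    hFc.comp (continuous_id.prodMk continuous_const).continuousOn fun x' hx' => ⟨hx', hs, le_rfl⟩
  set U' := U ∩ (fun x' => F x' s) ⁻¹' V with hU'
  have hU'n : U' ∈ 𝓝 x := inter_mem hU
    ((hslice.continuousAt hU).preimage_mem_nhds (by rwa [hFy]))
  refine ⟨U', hU'n, fun x' t => if t ≤ s then F x' t else G (F x' s) (t - s), ?_, ?_⟩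
  · have hle : IsClosed {p : M × ℝ | p.2 ≤ s} := isClosed_le continuous_snd continuous_const
    have hge : closure {p : M × ℝ | ¬ p.2 ≤ s} ⊆ {p | s ≤ p.2} :=
      closure_minimal (fun p hp => (not_le.1 hp).le) (isClosed_le continuous_const continuous_snd)
    refine ContinuousOn.if (p := fun p : M × ℝ => p.2 ≤ s) (f := fun p => F p.1 p.2)
      (g := fun p => G (F p.1 s) (p.2 - s)) ?_ ?_ ?_
    · rintro ⟨x', t⟩ ⟨hp, hfr⟩
      have hts : t = s := le_antisymm (hle.frontier_subset hfr)
        (hge (frontier_compl {p : M × ℝ | p.2 ≤ s} ▸ hfr : _ ∈ frontier _).1)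
      simp only [hts, sub_self]
      exact ((hG _ hp.1.2).1).symm
    · refine hFc.mono ?_
      rintro ⟨x', t⟩ ⟨hp, hcl⟩
      rw [hle.closure_eq] at hcl
      exact ⟨hp.1.1, hp.2.1, hcl⟩
    · refine hGc.comp (f := fun p : M × ℝ => (F p.1 s, p.2 - s)) ?_ ?_
      · refine ContinuousOn.prodMk ?_ (by fun_prop)
        exact hslice.comp continuousOn_fst fun p hp => hp.1.1.1
      · rintro ⟨x', t⟩ ⟨hp, hcl⟩
        exact ⟨hp.1.2, sub_nonneg.2 (hge hcl), by
          have := hp.2.2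
          dsimp only at this ⊢
          linarith⟩
  · rintro x' ⟨hx'U, hx'V⟩
    have h1 := hF x' hx'U
    have h2 := hG _ hx'V
    refine ⟨by simp [hs, h1.1], ?_, ?_⟩
    · have h3 := isMIntegralCurveOn_shift (c := -s) h2.2.1
      rw [zero_sub, neg_neg, sub_neg_eq_add, add_comm] at h3
      exact isMIntegralCurveOn_ite h1.2.1 h3 hs (by linarith) (by simp [h2.1])
    · intro u hu
      dsimp only
      split_ifs with hus
      · exact h1.2.2 ⟨hu.1, hus⟩
      · exact h2.2.2 ⟨by linarith, by linarith [hu.2]⟩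

/-- The local flow of a continuously differentiable vector field extends along integral curves. -/
theorem FlowRel.hasFlowNear (hO : IsOpen O)
    (hv : ∀ x ∈ O, ContMDiffAt I I.tangent 1 (fun x => (⟨x, v x⟩ : TangentBundle I M)) x)
    {t : ℝ} {x y : M} (h : FlowRel v O t x y) : ∃ ε > 0, HasFlowNear v O x (t + ε) := by
  obtain ⟨ht, γ, rfl, rfl, hi, hm⟩ := h
  have hbox : ∀ s ∈ Icc 0 t, ∃ ε > 0, HasFlowNear v O (γ s) ε := fun s hs =>
    exists_hasFlowNear (hO.mem_nhds (hm hs)) (hv _ (hm hs))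
  have hrel : ∀ s ∈ Icc 0 t, FlowRel v O s (γ 0) (γ s) := fun s hs =>
    ⟨hs.1, γ, rfl, rfl, hi.mono (Icc_subset_Icc_right hs.2),
      hm.mono_left (Icc_subset_Icc_right hs.2)⟩
  set S : Set ℝ := {s | HasFlowNear v O (γ 0) s} with hS
  -- The flow box at `γ s` also serves at nearby points `γ s'`, so a flow known up to `s'` slightly
  -- before `s` extends beyond `s` by a fixed amount. Applied at the supremum of the attainable
  -- times, this shows that the supremum is `t`.
  have hstep : ∀ s ∈ Icc 0 t, ∃ ε > 0, ∀ s' ∈ Icc 0 t, s' ∈ S → s' ≤ s → s - ε < s' →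
      s + ε ∈ S := by
    intro s hs
    obtain ⟨ε, hε, V, hV, G, hGc, hG⟩ := hbox s hs
    have h1 : ∀ᶠ u in 𝓝[Icc 0 t] s, γ u ∈ interior V :=
      (hi.continuousOn s hs) (interior_mem_nhds.2 hV)
    obtain ⟨δ, hδ, hδV⟩ := Metric.mem_nhdsWithin_iff.1 h1
    refine ⟨min δ (ε / 2), by positivity, fun s' hs' hS' hle hlt => ?_⟩
    have h2 : γ s' ∈ interior V := hδV ⟨by
      rw [Metric.mem_ball, Real.dist_eq, abs_lt]
      constructor <;> linarith [min_le_left δ (ε / 2)], hs'⟩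
    have h3 : HasFlowNear v O (γ s') ε := ⟨V, mem_interior_iff_mem_nhds.1 h2, G, hGc, hG⟩
    refine (HasFlowNear.extend hS' hs'.1 hε.le (hrel s' hs') h3 hv).mono ?_
    linarith [min_le_right δ (ε / 2)]
  have h0 : (0 : ℝ) ∈ S := by
    obtain ⟨ε, hε, h⟩ := hbox 0 ⟨le_rfl, ht⟩
    exact h.mono hε.le
  set A := S ∩ Icc 0 t with hA
  have hAne : A.Nonempty := ⟨0, h0, le_rfl, ht⟩
  have hAb : BddAbove A := ⟨t, fun s hs => hs.2.2⟩
  set σ := sSup A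
  have hσ : σ ∈ Icc 0 t := ⟨le_csSup hAb ⟨h0, le_rfl, ht⟩, csSup_le hAne fun s hs => hs.2.2⟩
  obtain ⟨ε, hε, hst⟩ := hstep σ hσ
  obtain ⟨s', hs', hlt⟩ := exists_lt_of_lt_csSup hAne (show σ - ε < sSup A by
    change σ - ε < σ; linarith)
  have hσε : σ + ε ∈ S := hst s' hs'.2 hs'.1 (le_csSup hAb hs') hlt
  have hσt : σ = t := by
    by_contra hne
    have hlt' : σ < t := lt_of_le_of_ne hσ.2 hne
    have h5 : min (σ + ε) t ∈ A := ⟨HasFlowNear.mono hσε (min_le_left _ _),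
      le_min (by linarith [hσ.1]) ht, min_le_right _ _⟩
    have h6 := le_csSup hAb h5
    have h7 : σ < min (σ + ε) t := lt_min (by linarith) hlt'
    exact absurd h6 (not_le.2 h7)
  exact ⟨ε, hε, hσt ▸ hσε⟩

theorem FlowRel.eventually (hO : IsOpen O)
    (hv : ∀ x ∈ O, ContMDiffAt I I.tangent 1 (fun x => (⟨x, v x⟩ : TangentBundle I M)) x)
    {t : ℝ} {x y : M} (h : FlowRel v O t x y) {W : Set M} (hW : W ∈ 𝓝 y) :
    ∀ᶠ p : ℝ × M in 𝓝 (t, x), 0 ≤ p.1 → ∃ y' ∈ W, FlowRel v O p.1 p.2 y' := by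
  obtain ⟨ε, hε, U, hU, F, hFc, hF⟩ := h.hasFlowNear hO hv
  have ht := h.1
  have hrel : ∀ x' ∈ U, ∀ t' ∈ Icc 0 (t + ε), FlowRel v O t' x' (F x' t') := by
    intro x' hx' t' ht'
    have hsub : Icc 0 t' ⊆ Icc 0 (t + ε) := Icc_subset_Icc_right ht'.2
    exact ⟨ht'.1, F x', (hF x' hx').1, rfl, (hF x' hx').2.1.mono hsub,
      (hF x' hx').2.2.mono_left hsub⟩
  have hxU := mem_of_mem_nhds hU
  have hFy : F x t = y := FlowRel.unique hv (hrel x hxU t ⟨ht, by linarith⟩) h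
  have h1 := hFc (x, t) ⟨hxU, ht, by linarith⟩
  have h2 : ∀ᶠ p : M × ℝ in 𝓝 (x, t), p ∈ U ×ˢ Icc 0 (t + ε) → F p.1 p.2 ∈ W :=
    eventually_nhdsWithin_iff.1 (h1 (by rwa [Function.uncurry_apply_pair, hFy]))
  have h3 : Tendsto (fun p : ℝ × M => (p.2, p.1)) (𝓝 (t, x)) (𝓝 (x, t)) :=
    continuous_swap.tendsto _
  have h4 : ∀ᶠ p : ℝ × M in 𝓝 (t, x), p.1 < t + ε :=
    continuous_fst.continuousAt.eventually (gt_mem_nhds (by dsimp only; linarith))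
  have h5 : ∀ᶠ p : ℝ × M in 𝓝 (t, x), p.2 ∈ U := continuous_snd.continuousAt.eventually hU
  filter_upwards [h3.eventually h2, h4, h5] with p hp hpt hpU h0
  exact ⟨F p.2 p.1, hp ⟨hpU, h0, hpt.le⟩, hrel _ hpU _ ⟨h0, hpt.le⟩⟩

end

/-- The local flow of a vector field that is continuously differentiable on an open set. -/
def vectorFieldFlow [CompleteSpace E] [BoundarylessManifold I M] [IsManifold I 1 M] [T2Space M]
    (v : ∀ x : M, TangentSpace I x) (O : Set M) (hO : IsOpen O)
    (hv : ∀ x ∈ O, ContMDiffAt I I.tangent 1 (fun x => (⟨x, v x⟩ : TangentBundle I M)) x) :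
    LocalFlow M where
  rel := FlowRel v O
  nonneg h := h.1
  eq_of_zero := fun ⟨_, γ, h0, h1, _⟩ => h0.symm.trans h1
  trans := FlowRel.trans
  split := FlowRel.split
  unique := FlowRel.unique hv
  injective h h' := h.reverse.unique (fun x hx => (hv x hx).neg_section) h'.reverse
  cont h _ hW := h.eventually hO hv hW
  cont_rev h W hW := by
    filter_upwards [h.reverse.eventually hO (fun x hx => (hv x hx).neg_section) hW] with p hp h0
    obtain ⟨x', hx', hr⟩ := hp h0
    exact ⟨x', hx', by simpa using hr.reverse⟩

end FlowRel
end GVF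

/-! ### Regularity of the gradients, the volume form and the guiding field -/

namespace GVF

section LinearAlgebra

variable {V : Type*} [NormedAddCommGroup V] [InnerProductSpace ℝ V] {n : ℕ}

/-- The product of two values of the volume form is a determinant of inner products. -/
theorem volumeForm_mul_volumeForm (o : Orientation ℝ V (Fin (n + 1)))
    [Fact (Module.finrank ℝ V = n + 1)] (v w : Fin (n + 1) → V) :
    o.volumeForm v * o.volumeForm w = (Matrix.of fun i j => ⟪v i, w j⟫).det := by
  set b := o.finOrthonormalBasis n.succ_pos Fact.out
  have hb : b.toBasis.orientation = o := o.finOrthonormalBasis_orientation n.succ_pos Fact.out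
  have h : (Matrix.of fun i j => ⟪v i, w j⟫) =
      (b.toBasis.toMatrix v).transpose * b.toBasis.toMatrix w := by
    ext i j
    simp only [Matrix.of_apply, Matrix.mul_apply, Matrix.transpose_apply, Module.Basis.toMatrix_apply,
      OrthonormalBasis.coe_toBasis_repr_apply, b.repr_apply_apply]
    rw [← b.sum_inner_mul_inner]
    simp_rw [real_inner_comm]
  rw [h, Matrix.det_mul, Matrix.det_transpose, o.volumeForm_robust b hb, Module.Basis.det_apply,
    Module.Basis.det_apply]

/-- The volume form is positive on positively oriented bases. -/
theorem volumeForm_pos (o : Orientation ℝ V (Fin (n + 1)))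
    [Fact (Module.finrank ℝ V = n + 1)] (b : Module.Basis (Fin (n + 1)) ℝ V)
    (hb : b.orientation = o) : 0 < o.volumeForm b := by
  set e := o.finOrthonormalBasis n.succ_pos Fact.out
  have he : e.toBasis.orientation = o := o.finOrthonormalBasis_orientation n.succ_pos Fact.out
  rw [o.volumeForm_robust e he]
  exact (Module.Basis.orientation_eq_iff_det_pos _ _).1 (he.trans hb.symm)

end LinearAlgebra

section Regularity

variable {E : Type*} [NormedAddCommGroup E] [NormedSpace ℝ E]
  {H : Type*} [TopologicalSpace H] {I : ModelWithCorners ℝ E H}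
  {M : Type*} [TopologicalSpace M] [ChartedSpace H M]

theorem contMDiffAt_det {ι : Type*} [Fintype ι] [DecidableEq ι] {k : WithTop ℕ∞}
    {A : M → Matrix ι ι ℝ} {x : M}
    (hA : ∀ i j, ContMDiffAt I 𝓘(ℝ, ℝ) k (fun x => A x i j) x) :
    ContMDiffAt I 𝓘(ℝ, ℝ) k (fun x => (A x).det) x := by
  simp only [Matrix.det_apply, Units.smul_def, zsmul_eq_mul]
  refine contMDiffAt_finsetSum fun σ _ => ContMDiffAt.mul contMDiffAt_const ?_
  exact contMDiffAt_finsetProd fun i _ => hA _ _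

theorem contMDiffAt_inv_apply {ι : Type*} [Fintype ι] [DecidableEq ι] {k : WithTop ℕ∞}
    {A : M → Matrix ι ι ℝ} {x : M}
    (hA : ∀ i j, ContMDiffAt I 𝓘(ℝ, ℝ) k (fun x => A x i j) x) (hx : (A x).det ≠ 0) (i j : ι) :
    ContMDiffAt I 𝓘(ℝ, ℝ) k (fun x => (A x)⁻¹ i j) x := by
  simp only [Matrix.inv_def, Ring.inverse_eq_inv', Matrix.smul_apply, smul_eq_mul,
    Matrix.adjugate_apply]
  refine ((contMDiffAt_det hA).inv₀ hx).mul (contMDiffAt_det fun a b => ?_)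
  by_cases h : a = j
  · subst h; simp only [Matrix.updateRow_self]; exact contMDiffAt_const
  · simp only [Matrix.updateRow_ne h]; exact hA a b

/-- The derivative of a function of class `C²` along a vector field of class `C¹`. -/
theorem contMDiffAt_mvfderiv_apply [IsManifold I 1 M] {f : M → ℝ}
    (hf : ContMDiff I 𝓘(ℝ, ℝ) 2 f) {Y : ∀ x : M, TangentSpace I x} {x : M}
    (hY : ContMDiffAt I I.tangent 1 (fun x => (⟨x, Y x⟩ : TangentBundle I M)) x) :
    ContMDiffAt I 𝓘(ℝ, ℝ) 1 (fun x => mvfderiv I f x (Y x)) x := by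
  have h1 : ContMDiff I.tangent 𝓘(ℝ, ℝ).tangent 1 (tangentMap I 𝓘(ℝ, ℝ) f) :=
    hf.contMDiff_tangentMap (by norm_num)
  exact ((contMDiff_snd_tangentBundle_modelSpace ℝ 𝓘(ℝ, ℝ)).comp h1).contMDiffAt.comp x hY

end Regularity

section Riemannian

variable {m : ℕ} {M : Type*} [TopologicalSpace M]
  [ChartedSpace (EuclideanSpace ℝ (Fin (m + 1))) M] [IsManifold (𝓡 (m + 1)) ∞ M]

theorem exists_localFrame (x₀ : M) : ∃ U ∈ 𝓝 x₀,
    ∃ X : Fin (m + 1) → ∀ x : M, TangentSpace (𝓡 (m + 1)) x,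
      IsLocalFrameOn (𝓡 (m + 1)) (EuclideanSpace ℝ (Fin (m + 1))) 1 X U := by
  set e := trivializationAt (EuclideanSpace ℝ (Fin (m + 1))) (TangentSpace (𝓡 (m + 1))) x₀
  exact ⟨e.baseSet, e.open_baseSet.mem_nhds (FiberBundle.mem_baseSet_trivializationAt' x₀), _,
    e.isLocalFrameOn_localFrame_baseSet (𝓡 (m + 1)) 1 (EuclideanSpace.basisFun _ ℝ).toBasis⟩

variable [RiemannianBundle (fun x : M => TangentSpace (𝓡 (m + 1)) x)]
  [IsContMDiffRiemannianBundle (𝓡 (m + 1)) ∞ (EuclideanSpace ℝ (Fin (m + 1)))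
    (fun x : M => TangentSpace (𝓡 (m + 1)) x)]

theorem contMDiffAt_inner {v w : ∀ x : M, TangentSpace (𝓡 (m + 1)) x} {x : M}
    (hv : ContMDiffAt (𝓡 (m + 1)) (𝓡 (m + 1)).tangent 1
      (fun x => (⟨x, v x⟩ : TangentBundle (𝓡 (m + 1)) M)) x)
    (hw : ContMDiffAt (𝓡 (m + 1)) (𝓡 (m + 1)).tangent 1
      (fun x => (⟨x, w x⟩ : TangentBundle (𝓡 (m + 1)) M)) x) :
    ContMDiffAt (𝓡 (m + 1)) 𝓘(ℝ, ℝ) 1 (fun x => ⟪v x, w x⟫) x :=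
  haveI : IsContMDiffRiemannianBundle (𝓡 (m + 1)) 1 (EuclideanSpace ℝ (Fin (m + 1)))
      (fun x : M => TangentSpace (𝓡 (m + 1)) x) :=
    IsContMDiffRiemannianBundle.of_le (n := ∞) (by exact_mod_cast le_top)
  ContMDiffAt.inner_bundle hv hw

/-- A vector field whose inner products with the fields of a local frame are continuously
differentiable is continuously differentiable. -/
theorem contMDiffAt_of_inner_frame {U : Set M} {x₀ : M} (hU : U ∈ 𝓝 x₀)
    {X : Fin (m + 1) → ∀ x : M, TangentSpace (𝓡 (m + 1)) x}
    (hX : IsLocalFrameOn (𝓡 (m + 1)) (EuclideanSpace ℝ (Fin (m + 1))) 1 X U)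
    {s : ∀ x : M, TangentSpace (𝓡 (m + 1)) x}
    (hs : ∀ i, ContMDiffAt (𝓡 (m + 1)) 𝓘(ℝ, ℝ) 1 (fun x => ⟪s x, X i x⟫) x₀) :
    ContMDiffAt (𝓡 (m + 1)) (𝓡 (m + 1)).tangent 1
      (fun x => (⟨x, s x⟩ : TangentBundle (𝓡 (m + 1)) M)) x₀ := by
  have hXs : ∀ i, ContMDiffAt (𝓡 (m + 1)) (𝓡 (m + 1)).tangent 1
      (fun x => (⟨x, X i x⟩ : TangentBundle (𝓡 (m + 1)) M)) x₀ :=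
    fun i => (hX.contMDiffOn i).contMDiffAt hU
  have hG : ∀ x ∈ U, (Matrix.gram ℝ fun i => X i x).det ≠ 0 := fun x hx =>
    Matrix.det_gram_ne_zero_iff_linearIndependent.2 (hX.linearIndependent hx)
  refine hX.contMDiffAt_of_coeff (fun i => ?_) hU
  -- The coefficients in the frame solve a linear system whose matrix is the invertible Gram matrix
  -- of the frame.
  have h1 : ContMDiffAt (𝓡 (m + 1)) 𝓘(ℝ, ℝ) 1
      (fun x => ∑ j, ⟪s x, X j x⟫ * (Matrix.gram ℝ fun i => X i x)⁻¹ j i) x₀ := by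
    refine contMDiffAt_finsetSum fun j _ => (hs j).mul ?_
    exact contMDiffAt_inv_apply (fun a b => contMDiffAt_inner (hXs a) (hXs b))
      (hG x₀ (mem_of_mem_nhds hU)) j i
  refine h1.congr_of_eventuallyEq (eventually_of_mem hU fun x hx => ?_)
  have h2 : (fun j => ⟪s x, X j x⟫) =
      Matrix.vecMul (fun i => hX.coeff i x (s x)) (Matrix.gram ℝ fun i => X i x) := by
    ext j
    conv_lhs => rw [hX.coeff_sum_eq s hx, sum_inner]
    simp only [Matrix.vecMul, dotProduct, Matrix.gram_apply, inner_smul_left, RCLike.conj_to_real]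
  have h3 : (fun i => hX.coeff i x (s x)) =
      Matrix.vecMul (fun j => ⟪s x, X j x⟫) (Matrix.gram ℝ fun i => X i x)⁻¹ := by
    rw [h2, Matrix.vecMul_vecMul, Matrix.mul_nonsing_inv _ (isUnit_iff_ne_zero.2 (hG x hx)),
      Matrix.vecMul_one]
  exact congrFun h3 i

theorem contMDiffAt_grad {f : M → ℝ} (hf : ContMDiff (𝓡 (m + 1)) 𝓘(ℝ, ℝ) 2 f) (x₀ : M) :
    ContMDiffAt (𝓡 (m + 1)) (𝓡 (m + 1)).tangent 1
      (fun x => (⟨x, grad f x⟩ : TangentBundle (𝓡 (m + 1)) M)) x₀ := by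
  obtain ⟨U, hU, X, hX⟩ := exists_localFrame (m := m) x₀
  refine contMDiffAt_of_inner_frame hU hX fun i => ?_
  simp only [grad, inner_sharp]
  exact contMDiffAt_mvfderiv_apply hf ((hX.contMDiffOn i).contMDiffAt hU)

/-- For a positively oriented frame `X`, `vol (w) = det ⟪wᵢ, Xⱼ⟫ / vol (X)` and `vol (X) = √det ⟪Xᵢ,
Xⱼ⟫`. The orientation fixes the sign of the root, and the right-hand sides are visibly of class
`C¹`. -/
theorem contMDiffAt_volumeForm (o : ManifoldOrientation m M)
    {w : Fin (m + 1) → ∀ x : M, TangentSpace (𝓡 (m + 1)) x} {x₀ : M}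
    (hw : ∀ i, ContMDiffAt (𝓡 (m + 1)) (𝓡 (m + 1)).tangent 1
      (fun x => (⟨x, w i x⟩ : TangentBundle (𝓡 (m + 1)) M)) x₀) :
    ContMDiffAt (𝓡 (m + 1)) 𝓘(ℝ, ℝ) 1
      (fun x => (o.at_point x).volumeForm (fun i => w i x)) x₀ := by
  obtain ⟨U, hU, X, hX, ho⟩ := o.exists_frame x₀
  have hXs : ∀ i, ContMDiffAt (𝓡 (m + 1)) (𝓡 (m + 1)).tangent 1
      (fun x => (⟨x, X i x⟩ : TangentBundle (𝓡 (m + 1)) M)) x₀ :=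
    fun i => ((hX.contMDiffOn i).of_le (by exact_mod_cast le_top)).contMDiffAt hU
  have hpos : ∀ x ∈ U, 0 < (o.at_point x).volumeForm (fun i => X i x) := by
    intro x hx
    have := volumeForm_pos (o.at_point x) (hX.toBasisAt hx) (ho x hx)
    have h2 : (⇑(hX.toBasisAt hx) : Fin (m + 1) → TangentSpace (𝓡 (m + 1)) x) =
      fun i => X i x := by ext1 i; simp
    rwa [h2] at this
  have hsq : ∀ x, (Matrix.of fun i j => ⟪X i x, X j x⟫).det =
      (o.at_point x).volumeForm (fun i => X i x) ^ 2 := fun x => by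
    rw [sq, volumeForm_mul_volumeForm]
  have hx₀ := mem_of_mem_nhds hU
  have h1 : ContMDiffAt (𝓡 (m + 1)) 𝓘(ℝ, ℝ) 1 (fun x =>
      (Matrix.of fun i j => ⟪w i x, X j x⟫).det *
        (√(Matrix.of fun i j => ⟪X i x, X j x⟫).det)⁻¹) x₀ := by
    refine (contMDiffAt_det fun i j => contMDiffAt_inner (hw i) (hXs j)).mul ?_
    have h2 : (Matrix.of fun i j => ⟪X i x₀, X j x₀⟫).det ≠ 0 := by
      rw [hsq]; exact pow_ne_zero _ (hpos x₀ hx₀).ne'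
    refine ContMDiffAt.inv₀ ?_ ?_
    · exact (Real.contDiffAt_sqrt h2).contMDiffAt.comp x₀
        (contMDiffAt_det fun i j => contMDiffAt_inner (hXs i) (hXs j))
    · rw [hsq, Real.sqrt_sq (hpos x₀ hx₀).le]; exact (hpos x₀ hx₀).ne'
  refine h1.congr_of_eventuallyEq (eventually_of_mem hU fun x hx => ?_)
  dsimp only
  rw [hsq, Real.sqrt_sq (hpos x hx).le, ← volumeForm_mul_volumeForm,
    mul_inv_cancel_right₀ (hpos x hx).ne']

theorem contMDiffAt_perp (o : ManifoldOrientation m M) {e : Fin m → M → ℝ}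
    (he : ∀ i, ContMDiff (𝓡 (m + 1)) 𝓘(ℝ, ℝ) 2 (e i)) (x₀ : M) :
    ContMDiffAt (𝓡 (m + 1)) (𝓡 (m + 1)).tangent 1
      (fun x => (⟨x, perp o e x⟩ : TangentBundle (𝓡 (m + 1)) M)) x₀ := by
  obtain ⟨U, hU, X, hX⟩ := exists_localFrame (m := m) x₀
  refine contMDiffAt_of_inner_frame hU hX fun i => ?_
  simp only [perp, inner_sharp, perpForm_apply]
  have := contMDiffAt_volumeForm o (x₀ := x₀) (w := Fin.snoc (α := fun _ =>
    ∀ x : M, TangentSpace (𝓡 (m + 1)) x) (fun i x => grad (e i) x) (X i)) (fun j => by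
      refine Fin.lastCases ?_ (fun j => ?_) j
      · simpa using (hX.contMDiffOn i).contMDiffAt hU
      · simpa using contMDiffAt_grad (he j) x₀)
  convert this using 3 with x
  ext1 j
  refine Fin.lastCases ?_ (fun j => ?_) j <;> simp

theorem contMDiffAt_guidingField (o : ManifoldOrientation m M) {e : Fin m → M → ℝ}
    (he : ∀ i, ContMDiff (𝓡 (m + 1)) 𝓘(ℝ, ℝ) 2 (e i)) (k : Fin m → ℝ) (x₀ : M) :
    ContMDiffAt (𝓡 (m + 1)) (𝓡 (m + 1)).tangent 1
      (fun x => (⟨x, guidingField o e k x⟩ : TangentBundle (𝓡 (m + 1)) M)) x₀ := by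
  refine ContMDiffAt.sub_section (contMDiffAt_perp o he x₀) ?_
  refine ContMDiffAt.sum_section fun i _ => ?_
  refine ContMDiffAt.smul_section (f := fun x => k i * e i x) ?_ (contMDiffAt_grad (he i) x₀)
  exact contMDiffAt_const.mul (((he i).of_le one_le_two) x₀)

end Riemannian
end GVF

/-! ### Product coordinates given by the surface functions -/

namespace GVF

section Curves

variable {E : Type*} [NormedAddCommGroup E] [NormedSpace ℝ E]
  {H : Type*} [TopologicalSpace H] {I : ModelWithCorners ℝ E H}
  {M : Type*} [TopologicalSpace M] [ChartedSpace H M] {v : ∀ x : M, TangentSpace I x}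

/-- The derivative of a function along an integral curve. -/
theorem hasDerivWithinAt_comp_integralCurve {f : M → ℝ} {γ : ℝ → M} {s : Set ℝ}
    (hγ : IsMIntegralCurveOn γ v s) {t : ℝ} (ht : t ∈ s)
    (hf : MDifferentiableAt I 𝓘(ℝ, ℝ) f (γ t)) :
    HasDerivWithinAt (fun t => f (γ t)) (mvfderiv I f (γ t) (v (γ t))) s t := by
  have h := hf.hasMFDerivAt.comp_hasMFDerivWithinAt t (hγ t ht)
  have h2 := h.hasFDerivWithinAt
  rw [hasDerivWithinAt_iff_hasFDerivWithinAt]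
  refine h2.congr_fderiv ?_
  refine ContinuousLinearMap.ext_ring ?_
  change mfderiv I 𝓘(ℝ, ℝ) f (γ t) ((1 : ℝ) • v (γ t)) =
    (1 : ℝ) • mfderiv I 𝓘(ℝ, ℝ) f (γ t) (v (γ t))
  exact map_smul _ _ _

theorem eq_add_mul_of_hasDerivWithinAt {f : ℝ → ℝ} {a b c : ℝ}
    (hf : ∀ t ∈ Icc a b, HasDerivWithinAt f c (Icc a b) t) {t : ℝ} (ht : t ∈ Icc a b) :
    f t = f a + (t - a) * c := by
  have h : ∀ t ∈ Icc a b, HasDerivWithinAt (fun t => f t - (t - a) * c) 0 (Icc a b) t := by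
    intro t ht
    have h1 := (hf t ht).fun_sub (((hasDerivWithinAt_id t (Icc a b)).sub_const a).mul_const c)
    simpa using h1
  have h2 := constant_of_derivWithin_zero (f := fun t => f t - (t - a) * c) (a := a) (b := b)
    (fun t ht => (h t ht).differentiableWithinAt) (fun t ht =>
      (h t ⟨ht.1, ht.2.le⟩).derivWithin (uniqueDiffOn_Icc (ht.1.trans_lt ht.2) t ⟨ht.1, ht.2.le⟩))
    t ht
  simp only [sub_self, zero_mul, sub_zero] at h2
  linarith

/-- The identity needed when the sign of `c` is reversed, stated in plain products to keep tangent
spaces out of the rewriting. -/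
theorem one_smul_fst_zero {A B : Type*} [AddCommGroup A] [AddCommGroup B] [Module ℝ A] [Module ℝ B]
    {a b d : A × B} (h : a = b) (h' : d = -b) (h'' : b.2 = 0) :
    (((1 : ℝ) • a).1, (0 : B)) = (1 : ℝ) • -d := by
  rw [h, h', one_smul, one_smul, neg_neg, ← h'']

end Curves

section Trivialization

variable {m : ℕ} {M : Type*} [TopologicalSpace M]
  [ChartedSpace (EuclideanSpace ℝ (Fin (m + 1))) M] 

/-- The horizontal lift to `M × ℝᵐ` of a vector field on `M`. -/
def horizontal (v : ∀ x : M, TangentSpace (𝓡 (m + 1)) x)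
    (p : M × EuclideanSpace ℝ (Fin m)) :
    TangentSpace ((𝓡 (m + 1)).prod 𝓘(ℝ, EuclideanSpace ℝ (Fin m))) p :=
  ((v p.1 : EuclideanSpace ℝ (Fin (m + 1))), (0 : EuclideanSpace ℝ (Fin m)))

theorem contMDiffAt_horizontal [IsManifold (𝓡 (m + 1)) ∞ M]
    {v : ∀ x : M, TangentSpace (𝓡 (m + 1)) x}
    {p : M × EuclideanSpace ℝ (Fin m)}
    (hv : ContMDiffAt (𝓡 (m + 1)) (𝓡 (m + 1)).tangent 1
      (fun x => (⟨x, v x⟩ : TangentBundle (𝓡 (m + 1)) M)) p.1) :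
    ContMDiffAt ((𝓡 (m + 1)).prod 𝓘(ℝ, EuclideanSpace ℝ (Fin m)))
      ((𝓡 (m + 1)).prod 𝓘(ℝ, EuclideanSpace ℝ (Fin m))).tangent 1
      (fun p => (⟨p, horizontal v p⟩ : TangentBundle ((𝓡 (m + 1)).prod
        𝓘(ℝ, EuclideanSpace ℝ (Fin m))) (M × EuclideanSpace ℝ (Fin m)))) p := by
  have : IsManifold (𝓡 (m + 1)) 1 M := IsManifold.of_le (n := ∞) (by exact_mod_cast le_top)
  have h1 := hv.comp p (contMDiffAt_fst (I := 𝓡 (m + 1))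
    (J := 𝓘(ℝ, EuclideanSpace ℝ (Fin m))) (n := 1))
  have h2 : ContMDiffAt 𝓘(ℝ, EuclideanSpace ℝ (Fin m)) 𝓘(ℝ, EuclideanSpace ℝ (Fin m)).tangent 1
      (fun c => (⟨c, (0 : EuclideanSpace ℝ (Fin m))⟩ :
        TangentBundle 𝓘(ℝ, EuclideanSpace ℝ (Fin m)) (EuclideanSpace ℝ (Fin m)))) p.2 :=
    contMDiffAt_vectorSpace_iff_contDiffAt.2 contDiffAt_const
  have h3 := h2.comp p (contMDiffAt_snd (I := 𝓡 (m + 1))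
    (J := 𝓘(ℝ, EuclideanSpace ℝ (Fin m))) (n := 1))
  exact contMDiff_equivTangentBundleProd_symm.contMDiffAt.comp p (h1.prodMk h3)

theorem mvfderiv_comp_fst_horizontal {f : M → ℝ} {v : ∀ x : M, TangentSpace (𝓡 (m + 1)) x}
    {p : M × EuclideanSpace ℝ (Fin m)} (hf : MDifferentiableAt (𝓡 (m + 1)) 𝓘(ℝ, ℝ) f p.1) :
    mvfderiv ((𝓡 (m + 1)).prod 𝓘(ℝ, EuclideanSpace ℝ (Fin m))) (fun p => f p.1) p
      (horizontal v p) = mvfderiv (𝓡 (m + 1)) f p.1 (v p.1) := by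
  have h := hf.hasMFDerivAt.comp p (hasMFDerivAt_fst (I := 𝓡 (m + 1))
    (I' := 𝓘(ℝ, EuclideanSpace ℝ (Fin m))) (x := p))
  have h2 : mfderiv ((𝓡 (m + 1)).prod 𝓘(ℝ, EuclideanSpace ℝ (Fin m))) 𝓘(ℝ, ℝ)
    (fun p : M × EuclideanSpace ℝ (Fin m) => f p.1) p = _ := h.mfderiv
  simp only [mvfderiv, h2]
  rfl

theorem mvfderiv_comp_snd_horizontal {f : EuclideanSpace ℝ (Fin m) → ℝ}
    {v : ∀ x : M, TangentSpace (𝓡 (m + 1)) x}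
    {p : M × EuclideanSpace ℝ (Fin m)}
    (hf : MDifferentiableAt 𝓘(ℝ, EuclideanSpace ℝ (Fin m)) 𝓘(ℝ, ℝ) f p.2) :
    mvfderiv ((𝓡 (m + 1)).prod 𝓘(ℝ, EuclideanSpace ℝ (Fin m))) (fun p : M × EuclideanSpace ℝ (Fin m) => f p.2) p
      (horizontal v p) = 0 := by
  have h := hf.hasMFDerivAt.comp p (hasMFDerivAt_snd (I := 𝓡 (m + 1))
    (I' := 𝓘(ℝ, EuclideanSpace ℝ (Fin m))) (x := p))
  have h2 : mfderiv ((𝓡 (m + 1)).prod 𝓘(ℝ, EuclideanSpace ℝ (Fin m))) 𝓘(ℝ, ℝ)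
    (fun p : M × EuclideanSpace ℝ (Fin m) => f p.2) p = _ := h.mfderiv
  simp only [mvfderiv, h2]
  exact map_zero (mfderiv 𝓘(ℝ, EuclideanSpace ℝ (Fin m)) 𝓘(ℝ, ℝ) f p.2)

variable [RiemannianBundle (fun x : M => TangentSpace (𝓡 (m + 1)) x)]

/-- The Gram matrix of the gradients of the functions `f i`. -/
noncomputable def gradGram (f : Fin m → M → ℝ) (x : M) : Matrix (Fin m) (Fin m) ℝ :=
  Matrix.gram ℝ fun i => grad (m := m) (f i) x

/-- The vector field on `M × ℝᵐ` that moves the values of the functions `f i` at the constant speed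
given by the second component. -/
noncomputable def fiberField (f : Fin m → M → ℝ) (p : M × EuclideanSpace ℝ (Fin m)) :
    TangentSpace ((𝓡 (m + 1)).prod 𝓘(ℝ, EuclideanSpace ℝ (Fin m))) p :=
  ∑ j, (∑ i, p.2 i * (gradGram (m := m) f p.1)⁻¹ i j) • horizontal (fun x => grad (m := m) (f j) x) p

variable {f : Fin m → M → ℝ}

/-- Along `∑ aⱼ grad fⱼ` the derivatives of the `fᵢ` are the entries of `a G`, with `G` the Gram
matrix; the field has `a = c G⁻¹`. -/
theorem mvfderiv_fiberField (hf : ∀ i, ContMDiff (𝓡 (m + 1)) 𝓘(ℝ, ℝ) 2 (f i))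
    {p : M × EuclideanSpace ℝ (Fin m)} (hp : (gradGram (m := m) f p.1).det ≠ 0) (i : Fin m) :
    mvfderiv ((𝓡 (m + 1)).prod 𝓘(ℝ, EuclideanSpace ℝ (Fin m))) (fun p => f i p.1) p
      (fiberField (m := m) f p) = p.2 i := by
  rw [fiberField, map_sum]
  have h1 : ∀ j, mvfderiv ((𝓡 (m + 1)).prod 𝓘(ℝ, EuclideanSpace ℝ (Fin m)))
      (fun p : M × EuclideanSpace ℝ (Fin m) => f i p.1) p
      ((∑ i, p.2 i * (gradGram (m := m) f p.1)⁻¹ i j) • horizontal (fun x => grad (m := m) (f j) x) p) =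
      Matrix.vecMul (fun i => p.2 i) (gradGram (m := m) f p.1)⁻¹ j * gradGram (m := m) f p.1 j i := by
    intro j
    rw [map_smul, mvfderiv_comp_fst_horizontal ((hf i).mdifferentiable two_ne_zero p.1),
      smul_eq_mul, ← inner_sharp, real_inner_comm]
    congr 1
  rw [Finset.sum_congr rfl fun j _ => h1 j]
  have h2 : Matrix.vecMul (Matrix.vecMul (fun i => p.2 i) (gradGram (m := m) f p.1)⁻¹) (gradGram (m := m) f p.1) =
      fun i => p.2 i := by
    rw [Matrix.vecMul_vecMul, Matrix.nonsing_inv_mul _ (isUnit_iff_ne_zero.2 hp),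
      Matrix.vecMul_one]
  exact congrFun h2 i

theorem mvfderiv_snd_fiberField (p : M × EuclideanSpace ℝ (Fin m)) (i : Fin m) :
    mvfderiv ((𝓡 (m + 1)).prod 𝓘(ℝ, EuclideanSpace ℝ (Fin m))) (fun p : M × EuclideanSpace ℝ (Fin m) => p.2 i) p
      (fiberField (m := m) f p) = 0 := by
  rw [fiberField, map_sum]
  refine Finset.sum_eq_zero fun j _ => ?_
  rw [map_smul, mvfderiv_comp_snd_horizontal (f := fun c => c i), smul_zero]
  exact (EuclideanSpace.proj (𝕜 := ℝ) i).differentiableAt.mdifferentiableAt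

theorem fiberField_neg (x : M) (c : EuclideanSpace ℝ (Fin m)) :
    (fiberField f (x, -c) : EuclideanSpace ℝ (Fin (m + 1)) × EuclideanSpace ℝ (Fin m)) =
      -(fiberField f (x, c) : EuclideanSpace ℝ (Fin (m + 1)) × EuclideanSpace ℝ (Fin m)) := by
  have h : ∀ j, ∑ i, (-c) i * (gradGram (m := m) f x)⁻¹ i j =
      -∑ i, c i * (gradGram (m := m) f x)⁻¹ i j := fun j => by
    simp [Finset.sum_neg_distrib]
  change ∑ j, (∑ i, (-c) i * (gradGram (m := m) f x)⁻¹ i j) •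
      (((grad (m := m) (f j) x : EuclideanSpace ℝ (Fin (m + 1))), (0 : EuclideanSpace ℝ (Fin m)))) =
    -∑ j, (∑ i, c i * (gradGram (m := m) f x)⁻¹ i j) •
      (((grad (m := m) (f j) x : EuclideanSpace ℝ (Fin (m + 1))), (0 : EuclideanSpace ℝ (Fin m))))
  rw [← Finset.sum_neg_distrib]
  refine Finset.sum_congr rfl fun j _ => ?_
  rw [h j, neg_smul]

theorem fiberField_snd (x : M) (c : EuclideanSpace ℝ (Fin m)) :
    (fiberField f (x, c) : EuclideanSpace ℝ (Fin (m + 1)) × EuclideanSpace ℝ (Fin m)).2 = 0 := by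
  change (∑ j, (∑ i, c i * (gradGram (m := m) f x)⁻¹ i j) •
    (((grad (m := m) (f j) x : EuclideanSpace ℝ (Fin (m + 1))), (0 : EuclideanSpace ℝ (Fin m))))).2 = 0
  rw [Prod.snd_sum]
  exact Finset.sum_eq_zero fun j _ => smul_zero _

theorem contMDiffAt_fiberField [IsManifold (𝓡 (m + 1)) ∞ M]
    [IsContMDiffRiemannianBundle (𝓡 (m + 1)) ∞ (EuclideanSpace ℝ (Fin (m + 1)))
      (fun x : M => TangentSpace (𝓡 (m + 1)) x)]
    (hf : ∀ i, ContMDiff (𝓡 (m + 1)) 𝓘(ℝ, ℝ) 2 (f i))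
    {p : M × EuclideanSpace ℝ (Fin m)} (hp : (gradGram (m := m) f p.1).det ≠ 0) :
    ContMDiffAt ((𝓡 (m + 1)).prod 𝓘(ℝ, EuclideanSpace ℝ (Fin m)))
      ((𝓡 (m + 1)).prod 𝓘(ℝ, EuclideanSpace ℝ (Fin m))).tangent 1
      (fun p => (⟨p, fiberField (m := m) f p⟩ : TangentBundle ((𝓡 (m + 1)).prod
        𝓘(ℝ, EuclideanSpace ℝ (Fin m))) (M × EuclideanSpace ℝ (Fin m)))) p := by
  have : IsManifold (𝓡 (m + 1)) 1 M := IsManifold.of_le (n := ∞) (by exact_mod_cast le_top)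
  refine ContMDiffAt.sum_section fun j _ => ?_
  refine ContMDiffAt.smul_section
    (f := fun p : M × EuclideanSpace ℝ (Fin m) =>
      ∑ i, p.2 i * (gradGram (m := m) f p.1)⁻¹ i j) ?_
    (contMDiffAt_horizontal (contMDiffAt_grad (hf j) p.1))
  refine contMDiffAt_finsetSum fun i _ => ContMDiffAt.mul ?_ ?_
  · exact (EuclideanSpace.proj (𝕜 := ℝ) i).contDiff.contMDiff.contMDiffAt.comp p contMDiffAt_snd
  · exact (contMDiffAt_inv_apply (fun a b => contMDiffAt_inner (contMDiffAt_grad (hf a) _)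
      (contMDiffAt_grad (hf b) _)) hp i j).comp p contMDiffAt_fst

/-- The map with components `f i`. -/
noncomputable def levelMap (f : Fin m → M → ℝ) (x : M) : EuclideanSpace ℝ (Fin m) :=
  WithLp.toLp 2 fun i => f i x

theorem fiberField_flow (hf : ∀ i, ContMDiff (𝓡 (m + 1)) 𝓘(ℝ, ℝ) 2 (f i))
    {O : Set (M × EuclideanSpace ℝ (Fin m))} (hO : ∀ p ∈ O, (gradGram (m := m) f p.1).det ≠ 0)
    {t : ℝ} {γ : ℝ → M × EuclideanSpace ℝ (Fin m)}
    (hγ : IsMIntegralCurveOn γ (fiberField (m := m) f) (Icc 0 t)) (hm : MapsTo γ (Icc 0 t) O)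
    {s : ℝ} (hs : s ∈ Icc 0 t) :
    (γ s).2 = (γ 0).2 ∧ levelMap f (γ s).1 = levelMap f (γ 0).1 + s • (γ 0).2 := by
  have h2 : ∀ s ∈ Icc 0 t, (γ s).2 = (γ 0).2 := by
    intro s hs
    ext i
    have h := eq_add_mul_of_hasDerivWithinAt (f := fun s => (γ s).2 i) (c := 0) (fun u hu => by
      have hd : MDifferentiableAt ((𝓡 (m + 1)).prod 𝓘(ℝ, EuclideanSpace ℝ (Fin m))) 𝓘(ℝ, ℝ)
          (fun p : M × EuclideanSpace ℝ (Fin m) => p.2 i) (γ u) :=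
        ((EuclideanSpace.proj (𝕜 := ℝ) i).differentiableAt.mdifferentiableAt).comp (γ u)
          mdifferentiableAt_snd
      have h := hasDerivWithinAt_comp_integralCurve hγ hu hd
      rwa [mvfderiv_snd_fiberField] at h) hs
    simpa using h
  refine ⟨h2 s hs, ?_⟩
  ext i
  have h := eq_add_mul_of_hasDerivWithinAt (f := fun s => f i (γ s).1) (c := (γ 0).2 i)
    (fun u hu => by
      have hd : MDifferentiableAt ((𝓡 (m + 1)).prod 𝓘(ℝ, EuclideanSpace ℝ (Fin m))) 𝓘(ℝ, ℝ)
          (fun p : M × EuclideanSpace ℝ (Fin m) => f i p.1) (γ u) :=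
        ((hf i).mdifferentiable two_ne_zero _).comp (γ u) mdifferentiableAt_fst
      have h := hasDerivWithinAt_comp_integralCurve hγ hu hd
      rwa [mvfderiv_fiberField hf (hO _ (hm hu)), h2 u hu] at h) hs
  simpa [levelMap] using h

/-- The functions `f i` can be trivialized near their common zero set if the zero set is compact
and the gradients are linearly independent there. -/
theorem exists_trivialization_levelMap [T2Space M] [IsManifold (𝓡 (m + 1)) ∞ M]
    [IsContMDiffRiemannianBundle (𝓡 (m + 1)) ∞ (EuclideanSpace ℝ (Fin (m + 1)))
      (fun x : M => TangentSpace (𝓡 (m + 1)) x)]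
    (hf : ∀ i, ContMDiff (𝓡 (m + 1)) 𝓘(ℝ, ℝ) 2 (f i))
    (hP : IsCompact {x | levelMap f x = 0}) [Nonempty {x | levelMap f x = 0}]
    (hdet : ∀ x, levelMap f x = 0 → (gradGram (m := m) f x).det ≠ 0) :
    ∃ r > 0, ∃ N : Set M, ∃ ρ : M → {x | levelMap f x = 0}, IsCompact N ∧
      N ∈ 𝓝ˢ {x | levelMap f x = 0} ∧ ContinuousOn ρ N ∧
      InjOn (fun x => (levelMap f x, ρ x)) N ∧
      ∀ c, ‖c‖ ≤ r → ∀ p, ∃ x ∈ N, levelMap f x = c ∧ ρ x = p := by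
  have : IsManifold (𝓡 (m + 1)) 1 M := IsManifold.of_le (n := ∞) (by exact_mod_cast le_top)
  set O : Set (M × EuclideanSpace ℝ (Fin m)) := {p | (gradGram (m := m) f p.1).det ≠ 0} with hOdef
  have hdc : Continuous fun x => (gradGram (m := m) f x).det :=
    continuous_iff_continuousAt.2 fun x => (contMDiffAt_det (k := 1) fun a b => contMDiffAt_inner
      (contMDiffAt_grad (hf a) _) (contMDiffAt_grad (hf b) _)).continuousAt
  have hO : IsOpen O := isOpen_ne_fun (hdc.comp continuous_fst) continuous_const
  have hy : Continuous (levelMap f) :=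
    (PiLp.continuous_toLp 2 _).comp (continuous_pi fun i => (hf i).continuous)
  set L := vectorFieldFlow (fiberField (m := m) f) O hO fun p hp => contMDiffAt_fiberField hf hp
  refine LocalFlow.exists_trivialization L hy hP ?_ ?_ ?_
  · rintro t x c z ⟨ht, γ, h0, rfl, hi, hm⟩
    have := fiberField_flow hf (fun p hp => hp) hi hm ⟨ht, le_rfl⟩
    rwa [h0] at this
  · rintro t x c x' ⟨ht, γ, h0, h1, hi, hm⟩
    have hc : ∀ s ∈ Icc 0 t, γ s = ((γ s).1, c) := fun s hs => by
      have := (fiberField_flow hf (fun p hp => hp) hi hm hs).1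
      rw [h0] at this
      exact Prod.ext rfl this
    -- The field is odd in `c`, so the same base curve with `-c` in place of `c` solves the equation
    -- of the negative field; reversing time gives the claim.
    suffices h : FlowRel (-fiberField (m := m) f) O t (x, -c) (x', -c) by
      have k := h.reverse
      rw [neg_neg] at k
      exact k
    refine ⟨ht, fun s => ((γ s).1, -c), by simp [h0], by simp [h1], fun s hs => ?_, fun s hs =>
      hm hs⟩
    have k1 := (hasMFDerivAt_fst (I := 𝓡 (m + 1))
      (I' := 𝓘(ℝ, EuclideanSpace ℝ (Fin m))) (x := γ s)).comp_hasMFDerivWithinAt s (hi s hs)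
    have k2 := k1.prodMk (hasMFDerivWithinAt_const (I := 𝓘(ℝ, ℝ))
      (I' := 𝓘(ℝ, EuclideanSpace ℝ (Fin m))) (-c) (Icc 0 t) s)
    refine k2.congr_mfderiv ?_
    refine ContinuousLinearMap.ext_ring ?_
    have k3 := fiberField_neg (f := f) (γ s).1 c
    have k4 := fiberField_snd (f := f) (γ s).1 c
    have k5 : (fiberField (m := m) f (γ s) :
        EuclideanSpace ℝ (Fin (m + 1)) × EuclideanSpace ℝ (Fin m)) =
        (fiberField (m := m) f ((γ s).1, c) :
        EuclideanSpace ℝ (Fin (m + 1)) × EuclideanSpace ℝ (Fin m)) := by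
      conv_lhs => rw [hc s hs]
    exact one_smul_fst_zero k5 k3 k4
  · intro x hx
    have h0 : fiberField (m := m) f (x, 0) = 0 := by simp [fiberField]
    refine ⟨zero_le_one, fun _ => (x, 0), rfl, rfl, ?_, fun _ _ => hdet x hx⟩
    exact (isMIntegralCurve_const h0).isMIntegralCurveOn _

end Trivialization
end GVF

/-! ### Trapping regions from a decreasing norm -/

namespace GVF

/-- Sublevel sets near a compact zero set are trapping regions if the flow decreases the norm. -/
theorem LocalFlow.exists_isTrap {X : Type*} [TopologicalSpace X] [T2Space X] {L : LocalFlow X}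
    {E : Type*} [NormedAddCommGroup E] {y : X → E} (hy : Continuous y) {N₀ A : Set X}
    (hN₀ : IsCompact N₀) (hN₀P : N₀ ∈ 𝓝ˢ {x | y x = 0}) (hA : IsOpen A)
    (hPA : {x | y x = 0} ⊆ A) {r₀ : ℝ} (hr₀ : 0 < r₀)
    (hcurve : ∀ x ∈ A, ∀ t : ℝ, ∃ γ : ℝ → X, γ 0 = x ∧ ContinuousOn γ (Icc 0 t) ∧
      ∀ s ∈ Icc 0 t, L.rel s x (γ s))
    (hdec : ∀ x ∈ A, ∀ t z, L.rel t x z → ‖y z‖ ≤ ‖y x‖)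
    (hsdec : ∀ x ∈ A, ∀ t > 0, ∀ z, L.rel t x z → y z ≠ 0 → ‖y z‖ < ‖y x‖) :
    ∃ r > 0, r ≤ r₀ ∧ N₀ ∩ {x | ‖y x‖ ≤ r} ⊆ A ∧ L.IsTrap (N₀ ∩ {x | ‖y x‖ ≤ r}) y r := by
  set G := interior N₀ ∩ A with hG
  have hGo : IsOpen G := isOpen_interior.inter hA
  -- `‖y‖` has a positive lower bound `r₁` on the compact set `N₀ \ G`, so every level below `r₁`
  -- cuts out a part of `N₀` inside the open set `G`.
  obtain ⟨r₁, hr₁, hr₁'⟩ := (hN₀.diff hGo).exists_forall_le' (f := fun x => ‖y x‖) (a := 0)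
    hy.norm.continuousOn fun x hx => norm_pos_iff.2 fun h =>
      hx.2 ⟨subset_interior_iff_mem_nhdsSet.2 hN₀P h, hPA h⟩
  set r := min r₀ (r₁ / 2)
  have hr : 0 < r := lt_min hr₀ (half_pos hr₁)
  set N := N₀ ∩ {x | ‖y x‖ ≤ r}
  have hNG : N ⊆ G := by
    intro x hx
    by_contra h
    have h1 := hr₁' x ⟨hx.1, h⟩
    have h2 : ‖y x‖ ≤ r₁ / 2 := hx.2.trans (min_le_right _ _)
    linarith
  have hcl : IsClosed {x | ‖y x‖ ≤ r} := isClosed_le hy.norm continuous_const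
  have hNcl : IsClosed N := hN₀.isClosed.inter hcl
  refine ⟨r, hr, min_le_left _ _, hNG.trans inter_subset_right, hN₀.inter_right hcl, hNcl,
    hy.continuousOn, fun x hx => hx.2, ?_, ?_⟩
  · have : {x | x ∈ N ∧ ‖y x‖ < r} = G ∩ {x | ‖y x‖ < r} := by
      ext x
      exact ⟨fun h => ⟨hNG h.1, h.2⟩,
        fun h => ⟨⟨interior_subset h.1.1, (le_of_lt h.2 : ‖y x‖ ≤ r)⟩, h.2⟩⟩
    rw [this]
    exact hGo.inter (isOpen_lt hy.norm continuous_const)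
  · intro x hx t ht
    have hxA : x ∈ A := (hNG hx).2
    obtain ⟨γ, h0, hγ, hrel⟩ := hcurve x hxA t
    -- The orbit cannot leave through the edge of `N₀`, because `N` lies in the open set `G`, nor
    -- through the level `r`, because the norm does not increase.
    have hsub : Icc 0 t ⊆ {s | γ s ∈ N} := by
      refine IsClosed.Icc_subset_of_forall_mem_nhdsWithin ?_ (show γ 0 ∈ N from h0.symm ▸ hx) ?_
      · have := hγ.preimage_isClosed_of_isClosed isClosed_Icc hNcl
        rwa [inter_comm] at this
      · rintro s ⟨hs, hst⟩
        have h1 : ∀ᶠ u in 𝓝[Icc 0 t] s, γ u ∈ G :=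
          (hγ s ⟨hst.1, hst.2.le⟩).eventually (hGo.mem_nhds (hNG hs))
        have h2 : Ioc s t ∈ 𝓝[>] s := Ioc_mem_nhdsGT hst.2
        have h3 : 𝓝[>] s ≤ 𝓝[Icc 0 t] s := nhdsWithin_le_of_mem
          (mem_of_superset h2 fun u hu => ⟨hst.1.trans hu.1.le, hu.2⟩)
        filter_upwards [h3 h1, h2] with u hu hu'
        exact ⟨interior_subset hu.1,
          (hdec x hxA u _ (hrel u ⟨hst.1.trans hu'.1.le, hu'.2⟩)).trans hx.2⟩
    have htt : t ∈ Icc 0 t := ⟨ht.le, le_rfl⟩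
    refine ⟨γ t, hrel t htt, hsub htt, ?_⟩
    by_cases hz : y (γ t) = 0
    · rwa [hz, norm_zero]
    · exact (hsdec x hxA t ht _ (hrel t htt) hz).trans_le hx.2

/-! ### Concatenation of trajectories and convergence -/

section Trajectories

variable {m : ℕ} {M : Type*} [EMetricSpace M]
  [ChartedSpace (EuclideanSpace ℝ (Fin (m + 1))) M]
  {v : ∀ x : M, TangentSpace (𝓡 (m + 1)) x}

theorem IsTrajectory.flowRel {x : M} {γ : ℝ → M} (h : IsTrajectory v x γ) {t : ℝ} (ht : 0 ≤ t) :
    FlowRel v univ t x (γ t) :=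
  ⟨ht, γ, h.1, rfl, h.2.mono Icc_subset_Ici_self, mapsTo_univ _ _⟩

theorem FlowRel.exists_isTrajectory {t : ℝ} {x z : M} (h : FlowRel v univ t x z) {γ : ℝ → M}
    (hγ : IsTrajectory v z γ) :
    ∃ γ', IsTrajectory v x γ' ∧ ∀ s, 0 ≤ s → γ' (s + t) = γ s := by
  obtain ⟨ht, η, h0, h1, hi, -⟩ := h
  refine ⟨fun u => if u ≤ t then η u else γ (u - t), ⟨by simp [ht, h0], fun u hu => ?_⟩,
    fun s hs => ?_⟩
  · set b := max u t + 1
    have hub : u < b := (le_max_left u t).trans_lt (lt_add_one _)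
    have htb : t ≤ b := (le_max_right u t).trans (lt_add_one _).le
    have h3 : IsMIntegralCurveOn (fun u => γ (u - t)) v (Icc t b) := by
      have := isMIntegralCurveOn_shift (c := -t)
        (hγ.2.mono (Icc_subset_Ici_self (a := b - t) (b := 0)))
      rwa [zero_sub, neg_neg, sub_neg_eq_add, sub_add_cancel] at this
    have h4 := isMIntegralCurveOn_ite hi h3 ht htb (by simp [h1, hγ.1])
    refine (h4 u ⟨hu, hub.le⟩).mono_of_mem_nhdsWithin ?_
    filter_upwards [self_mem_nhdsWithin, mem_nhdsWithin_of_mem_nhds (Iio_mem_nhds hub)]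
      with w hw hw'
    exact ⟨hw, le_of_lt hw'⟩
  · rcases hs.eq_or_lt with rfl | hs
    · simp [h1, hγ.1]
    · simp [hs]

theorem mem_domainOfAttraction_of_flowRel {A : Set M} {t : ℝ} {x z : M}
    (h : FlowRel v univ t x z) (hz : z ∈ domainOfAttraction v A) : x ∈ domainOfAttraction v A := by
  obtain ⟨γ, hγ, hc⟩ := hz
  obtain ⟨γ', hγ', he⟩ := h.exists_isTrajectory hγ
  refine ⟨γ', hγ', ?_⟩
  have h1 := hc.comp (tendsto_atTop_add_const_right atTop (-t) tendsto_id)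
  refine h1.congr' ?_
  filter_upwards [eventually_ge_atTop t] with u hu
  have := he (u - t) (by linarith)
  rw [sub_add_cancel] at this
  simp [this, sub_eq_add_neg]

/-- The singular points that are reached from attracted points belong to the attracting set. -/
theorem mem_of_flowRel_of_eq_zero {A : Set M} (hA : IsClosed A) {t : ℝ} {x z : M}
    (hx : ∀ γ : ℝ → M, IsTrajectory v x γ → ConvergesTo γ A) (h : FlowRel v univ t x z)
    (hz : v z = 0) : z ∈ A := by
  -- Resting at `z` forever continues the orbit of `x`; it must converge to the closed set `A`, so
  -- its constant value lies in `A`.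
  obtain ⟨γ, hγ, he⟩ := h.exists_isTrajectory (γ := fun _ => z)
    ⟨rfl, (isMIntegralCurve_const hz).isMIntegralCurveOn _⟩
  have h1 : Tendsto (fun _ : ℝ => Metric.infEDist z A) atTop (𝓝 0) := by
    refine (hx γ hγ).congr' ?_
    filter_upwards [eventually_ge_atTop t] with u hu
    have := he (u - t) (by linarith)
    rw [sub_add_cancel] at this
    rw [this]
  have h2 := tendsto_nhds_unique tendsto_const_nhds h1
  rw [← hA.closure_eq]
  exact Metric.mem_closure_iff_infEDist_zero.2 h2

end Trajectories

/-! ### The Lyapunov function of the guiding field -/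

section GuidingField

variable {m : ℕ} {M : Type*} {e : Fin m → M → ℝ} {k : Fin m → ℝ}

/-- The surface functions, scaled by the square roots of the gains. -/
noncomputable def scaledFun (e : Fin m → M → ℝ) (k : Fin m → ℝ) (i : Fin m) (x : M) : ℝ :=
  √(k i) * e i x


theorem norm_sq_levelMap_scaledFun (hk : ∀ i, 0 < k i) (x : M) :
    ‖levelMap (scaledFun e k) x‖ ^ 2 = ∑ i, k i * e i x ^ 2 := by
  rw [EuclideanSpace.norm_sq_eq]
  refine Finset.sum_congr rfl fun i _ => ?_
  simp [levelMap, scaledFun, mul_pow, Real.sq_sqrt (hk i).le]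

theorem setOf_levelMap_scaledFun_eq_zero (hk : ∀ i, 0 < k i) :
    {x | levelMap (scaledFun e k) x = 0} = desiredPath e := by
  ext x
  have h : levelMap (scaledFun e k) x = 0 ↔ ∀ i, √(k i) * e i x = 0 :=
    ⟨fun h i => congrArg (fun c : EuclideanSpace ℝ (Fin m) => c i) h, fun h => by ext i; exact h i⟩
  simp [h, desiredPath, (Real.sqrt_pos.2 (hk _)).ne']

variable [TopologicalSpace M] [ChartedSpace (EuclideanSpace ℝ (Fin (m + 1))) M]

theorem contMDiff_scaledFun (he : ∀ i, ContMDiff (𝓡 (m + 1)) 𝓘(ℝ, ℝ) 2 (e i)) (i : Fin m) :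
    ContMDiff (𝓡 (m + 1)) 𝓘(ℝ, ℝ) 2 (scaledFun e k i) :=
  contMDiff_const.mul (he i)

variable [RiemannianBundle (fun x : M => TangentSpace (𝓡 (m + 1)) x)] {x : M}

theorem grad_const_mul {f : M → ℝ} (hf : MDifferentiableAt (𝓡 (m + 1)) 𝓘(ℝ, ℝ) f x)
    (c : ℝ) : grad (m := m) (fun x => c * f x) x = c • grad (m := m) f x := by
  refine ext_inner_right ℝ fun v => ?_
  rw [real_inner_smul_left, grad, grad, inner_sharp, inner_sharp]
  have h : mfderiv (𝓡 (m + 1)) 𝓘(ℝ, ℝ) (fun x => c * f x) x = _ :=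
    (hf.hasMFDerivAt.const_smul c).mfderiv
  simp only [mvfderiv, h]
  rfl

theorem det_gradGram_scaledFun_ne_zero (hk : ∀ i, 0 < k i)
    (he : ∀ i, MDifferentiableAt (𝓡 (m + 1)) 𝓘(ℝ, ℝ) (e i) x)
    (h : LinearIndependent ℝ fun i => grad (m := m) (e i) x) :
    (gradGram (m := m) (scaledFun e k) x).det ≠ 0 := by
  rw [gradGram, Matrix.det_gram_ne_zero_iff_linearIndependent]
  have := h.units_smul fun i => Units.mk0 _ (Real.sqrt_pos.2 (hk i)).ne'
  have h1 : (fun i => grad (m := m) (scaledFun e k i) x) =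
      (fun i => Units.mk0 _ (Real.sqrt_pos.2 (hk i)).ne') • fun i => grad (m := m) (e i) x :=
    funext fun i => grad_const_mul (he i) _
  rw [h1]
  exact this

variable [IsManifold (𝓡 (m + 1)) ∞ M] (o : ManifoldOrientation m M)

/-- The volume form then has a repeated argument. -/
theorem inner_grad_perp (i : Fin m) : ⟪grad (m := m) (e i) x, perp o e x⟫ = 0 := by
  rw [real_inner_comm, perp, inner_sharp, perpForm_apply]
  exact (o.at_point x).volumeForm.map_eq_zero_of_eq _ (i := i.castSucc) (j := Fin.last m)
    (by simp) (Fin.castSucc_lt_last i).ne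

theorem perp_eq_zero (h : ¬ LinearIndependent ℝ fun i => grad (m := m) (e i) x) :
    perp o e x = 0 := by
  refine ext_inner_right ℝ fun v => ?_
  rw [perp, inner_sharp, perpForm_apply, inner_zero_left]
  refine (o.at_point x).volumeForm.map_linearDependent _ fun h' => h ?_
  have := h'.comp Fin.castSucc (Fin.castSucc_injective m)
  simpa [Function.comp_def] using this

/-- Off the desired path the radial part of the guiding field vanishes only at singular points. -/
theorem guidingField_eq_zero (hk : ∀ i, 0 < k i) (hx : x ∉ desiredPath e)
    (h : ∑ i, (k i * e i x) • grad (m := m) (e i) x = 0) : guidingField o e k x = 0 := by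
  rw [guidingField, h, sub_zero]
  refine perp_eq_zero o fun hli => hx fun i => ?_
  have := Fintype.linearIndependent_iff.1 hli _ h i
  exact (mul_eq_zero.1 this).resolve_left (hk i).ne'

/-- On the path the guiding field is `⊥_e`, which vanishes when the gradients are dependent. -/
theorem linearIndependent_grad (hx : x ∈ desiredPath e) (h : guidingField o e k x ≠ 0) :
    LinearIndependent ℝ fun i => grad (m := m) (e i) x := by
  by_contra hli
  refine h ?_
  rw [guidingField, perp_eq_zero o hli, zero_sub, neg_eq_zero]
  exact Finset.sum_eq_zero fun i _ => by rw [hx i, mul_zero, zero_smul]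

/-- The Lyapunov function decreases along the guiding field. -/
theorem hasDerivWithinAt_norm_sq_levelMap (hk : ∀ i, 0 < k i)
    (he : ∀ i, MDifferentiable (𝓡 (m + 1)) 𝓘(ℝ, ℝ) (e i)) {γ : ℝ → M} {s : Set ℝ}
    (hγ : IsMIntegralCurveOn γ (guidingField o e k) s) {t : ℝ} (ht : t ∈ s) :
    HasDerivWithinAt (fun t => ‖levelMap (scaledFun e k) (γ t)‖ ^ 2)
      (-2 * ‖∑ i, (k i * e i (γ t)) • grad (m := m) (e i) (γ t)‖ ^ 2) s t := by
  set g := ∑ i, (k i * e i (γ t)) • grad (m := m) (e i) (γ t) with hg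
  have h1 : ∀ i, HasDerivWithinAt (fun t => e i (γ t)) (-⟪grad (m := m) (e i) (γ t), g⟫) s t := by
    intro i
    have h := hasDerivWithinAt_comp_integralCurve hγ ht (he i (γ t))
    rwa [← inner_sharp, ← grad, guidingField, inner_sub_right, inner_grad_perp, zero_sub] at h
  have h2 := HasDerivWithinAt.fun_sum (u := Finset.univ) fun i _ => ((h1 i).fun_pow 2).const_mul (k i)
  simp only [norm_sq_levelMap_scaledFun hk]
  refine h2.congr_deriv ?_
  symm
  rw [← real_inner_self_eq_norm_sq]
  conv_lhs => rw [hg, sum_inner, ← hg]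
  rw [Finset.mul_sum]
  refine Finset.sum_congr rfl fun i _ => ?_
  rw [real_inner_smul_left]
  push_cast
  ring

theorem norm_levelMap_antitoneOn (hk : ∀ i, 0 < k i)
    (he : ∀ i, MDifferentiable (𝓡 (m + 1)) 𝓘(ℝ, ℝ) (e i)) {γ : ℝ → M} {t : ℝ}
    (hγ : IsMIntegralCurveOn γ (guidingField o e k) (Icc 0 t)) :
    AntitoneOn (fun t => ‖levelMap (scaledFun e k) (γ t)‖ ^ 2) (Icc 0 t) := by
  have hd := fun s hs => hasDerivWithinAt_norm_sq_levelMap o hk he hγ (t := s) hs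
  refine antitoneOn_of_hasDerivWithinAt_nonpos (convex_Icc 0 t)
    (fun s hs => (hd s hs).continuousWithinAt)
    (fun s hs => (hd s (interior_subset hs)).mono interior_subset) fun s _ => ?_
  nlinarith [sq_nonneg ‖∑ i, (k i * e i (γ s)) • grad (m := m) (e i) (γ s)‖]

theorem norm_levelMap_strictAntiOn (hk : ∀ i, 0 < k i)
    (he : ∀ i, MDifferentiable (𝓡 (m + 1)) 𝓘(ℝ, ℝ) (e i)) {γ : ℝ → M} {t : ℝ}
    (hγ : IsMIntegralCurveOn γ (guidingField o e k) (Icc 0 t))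
    (hP : ∀ s ∈ Icc 0 t, γ s ∉ desiredPath e) (h0 : ∀ s ∈ Icc 0 t, guidingField o e k (γ s) ≠ 0) :
    StrictAntiOn (fun t => ‖levelMap (scaledFun e k) (γ t)‖ ^ 2) (Icc 0 t) := by
  have hd := fun s hs => hasDerivWithinAt_norm_sq_levelMap o hk he hγ (t := s) hs
  refine strictAntiOn_of_hasDerivWithinAt_neg (convex_Icc 0 t)
    (fun s hs => (hd s hs).continuousWithinAt)
    (fun s hs => (hd s (interior_subset hs)).mono interior_subset) fun s hs => ?_
  have hs' := interior_subset hs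
  have : 0 < ‖∑ i, (k i * e i (γ s)) • grad (m := m) (e i) (γ s)‖ :=
    norm_pos_iff.2 fun h => h0 s hs' (guidingField_eq_zero o hk (hP s hs') h)
  have := pow_pos this 2
  linarith

end GuidingField
end GVF

/-! ### Proof of the theorem -/

theorem mainTheorem1 {m : ℕ} {M : Type*} [EMetricSpace M]
    [ChartedSpace (EuclideanSpace ℝ (Fin (m + 1))) M] [IsManifold (𝓡 (m + 1)) ∞ M]
    [RiemannianBundle (fun x : M => TangentSpace (𝓡 (m + 1)) x)]
    [IsContMDiffRiemannianBundle (𝓡 (m + 1)) ∞ (EuclideanSpace ℝ (Fin (m + 1)))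
      (fun x : M => TangentSpace (𝓡 (m + 1)) x)]
    [IsRiemannianManifold (𝓡 (m + 1)) M]
    (o : GVF.ManifoldOrientation m M)
    (e : Fin m → M → ℝ) (he : ∀ i, ContMDiff (𝓡 (m + 1)) 𝓘(ℝ, ℝ) 2 (e i))
    (k : Fin m → ℝ) (hk : ∀ i, 0 < k i)
    (hsing : GVF.singularSet o e k = ∅ ∨
      0 < GVF.setDist (GVF.singularSet o e k) (GVF.desiredPath e))
    (hcircle : Nonempty (GVF.desiredPath e ≃ₜ Circle))
    (hstable : GVF.IsAsymptoticallyStable (GVF.guidingField o e k) (GVF.desiredPath e)) :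
    Nonempty (GVF.domainOfAttraction (GVF.guidingField o e k) (GVF.desiredPath e) ≃ₜ
      EuclideanSpace ℝ (Fin m) × Circle) := by
  have : IsManifold (𝓡 (m + 1)) 1 M := IsManifold.of_le (n := ∞) (by exact_mod_cast le_top)
  obtain ⟨h⟩ := hcircle
  set P := GVF.desiredPath e
  set χ := GVF.guidingField o e k
  have hPc : IsCompact P := isCompact_iff_compactSpace.2 h.symm.compactSpace
  -- A singular point on the path would make the distance of the two sets zero.
  have hPC : ∀ x ∈ P, χ x ≠ 0 := by
    intro x hx h0
    have hxC : x ∈ GVF.singularSet o e k := h0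
    rcases hsing with hC | hC
    · rw [hC] at hxC; exact hxC
    · refine hC.not_ge ?_
      exact (iInf₂_le_of_le x hxC (iInf₂_le x hx)).trans (edist_self x).le
  have hd : ∀ i, MDifferentiable (𝓡 (m + 1)) 𝓘(ℝ, ℝ) (e i) := fun i =>
    (he i).mdifferentiable two_ne_zero
  set y := GVF.levelMap (GVF.scaledFun e k) with hy
  have hyP : {x | y x = 0} = P := GVF.setOf_levelMap_scaledFun_eq_zero hk
  have hyc : Continuous y := (PiLp.continuous_toLp 2 _).comp
    (continuous_pi fun i => (GVF.contMDiff_scaledFun he i).continuous)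
  have : Nonempty {x | y x = 0} := by rw [hyP]; exact ⟨h.symm 1⟩
  obtain ⟨r₀, hr₀, N₀, ρ, hN₀, hN₀P, hρ, hinj, hsurj⟩ := GVF.exists_trivialization_levelMap
    (GVF.contMDiff_scaledFun (k := k) he) (hyP ▸ hPc) fun x hx => by
      have hxP : x ∈ P := hyP ▸ hx
      exact GVF.det_gradGram_scaledFun_ne_zero hk (fun i => hd i x)
        (GVF.linearIndependent_grad o hxP (hPC x hxP))
  set L := GVF.vectorFieldFlow χ univ isOpen_univ fun x _ => GVF.contMDiffAt_guidingField o he k x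
  obtain ⟨δ, hδ, hatt⟩ := hstable.attractive
  set A := {x | Metric.infEDist x P < δ}
  have hA : IsOpen A := isOpen_lt Metric.continuous_infEDist continuous_const
  have hPA : P ⊆ A := fun x hx => by
    change Metric.infEDist x P < δ
    rwa [Metric.infEDist_zero_of_mem hx]
  have hdec : ∀ x ∈ A, ∀ t z, L.rel t x z → ‖y z‖ ≤ ‖y x‖ := by
    rintro x - t z ⟨ht, γ, rfl, rfl, hγ, -⟩
    exact pow_le_pow_iff_left₀ (norm_nonneg _) (norm_nonneg _) two_ne_zero |>.1
      (GVF.norm_levelMap_antitoneOn o hk hd hγ ⟨le_rfl, ht⟩ ⟨ht, le_rfl⟩ ht)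
  obtain ⟨r, hr, hrr, hNA, hN⟩ := GVF.LocalFlow.exists_isTrap (L := L) hyc hN₀ hN₀P hA
    (hyP ▸ hPA) hr₀ (fun x hx t => by
      obtain ⟨γ, hγ⟩ := (hatt x hx).1
      exact ⟨γ, hγ.1, hγ.2.continuousOn.mono Icc_subset_Ici_self, fun s hs => hγ.flowRel hs.1⟩)
    -- If `y ≠ 0` at the end, monotonicity keeps the orbit off `P` throughout. A singular point on
    -- the orbit would lie in `P` by attraction, contradicting `hPC`. So the decrease is strict.
    hdec (by
      rintro x hx t ht z ⟨-, γ, rfl, rfl, hγ, hm⟩ hz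
      have hanti := GVF.norm_levelMap_antitoneOn o hk hd hγ
      refine pow_lt_pow_iff_left₀ (norm_nonneg _) (norm_nonneg _) two_ne_zero |>.1
        (GVF.norm_levelMap_strictAntiOn o hk hd hγ (fun s hs hs' => hz ?_) (fun s hs hs' => ?_)
          ⟨le_rfl, ht.le⟩ ⟨ht.le, le_rfl⟩ ht)
      · have h1 := hanti hs ⟨ht.le, le_rfl⟩ hs.2
        have h2 : y (γ s) = 0 := by
          change γ s ∈ {x | y x = 0}
          rwa [hyP]
        simp only [← hy, h2, norm_zero] at h1
        exact norm_eq_zero.1 (pow_eq_zero_iff two_ne_zero |>.1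
          (le_antisymm (by simpa using h1) (sq_nonneg _)))
      · have hrel : GVF.FlowRel χ univ s (γ 0) (γ s) :=
          ⟨hs.1, γ, rfl, rfl, hγ.mono (Icc_subset_Icc_right hs.2), mapsTo_univ _ _⟩
        exact hPC _ (GVF.mem_of_flowRel_of_eq_zero hPc.isClosed (hatt _ hx).2 hrel hs') hs')
  set N := N₀ ∩ {x | ‖y x‖ ≤ r} with hNdef
  have hNP : N ∈ 𝓝ˢ P := by
    rw [hyP] at hN₀P
    refine inter_mem hN₀P (mem_of_superset
      ((isOpen_lt hyc.norm (continuous_const (y := r))).mem_nhdsSet.2 fun x hx => ?_)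
      fun x hx => (le_of_lt hx : ‖y x‖ ≤ r))
    have h2 : y x = 0 := by
      change x ∈ {x | y x = 0}
      rwa [hyP]
    simpa [h2] using hr
  -- A trajectory converging to the compact set `P` enters its neighborhood `N`; conversely `N ⊆ A`,
  -- so orbits that reach `N` are attracted.
  have hbasin : GVF.domainOfAttraction χ P = L.basin N := by
    ext x
    constructor
    · rintro ⟨γ, hγ, hc⟩
      obtain ⟨ε, hε, hεN⟩ := hPc.exists_thickening_subset_open isOpen_interior
        (subset_interior_iff_mem_nhdsSet.2 hNP)
      obtain ⟨t, ht, ht0⟩ := ((hc.eventually (gt_mem_nhds (ENNReal.ofReal_pos.2 hε))).and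
        (eventually_ge_atTop 0)).exists
      exact ⟨t, γ t, hγ.flowRel ht0, interior_subset (hεN ht)⟩
    · rintro ⟨t, z, hrel, hz⟩
      obtain ⟨⟨γ, hγ⟩, hconv⟩ := hatt z (hNA hz)
      exact GVF.mem_domainOfAttraction_of_flowRel hrel ⟨γ, hγ, hconv γ hγ⟩
  set φ : {x | y x = 0} ≃ₜ Circle := (Homeomorph.setCongr hyP).trans h
  rw [hbasin]
  refine hN.nonempty_homeomorph hr (θ := fun x => φ (ρ x))
    (φ.continuous.comp_continuousOn (hρ.mono inter_subset_left)) (fun x hx x' hx' hxx => ?_)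
    fun c hc q => ?_
  · refine hinj hx.1 hx'.1 ?_
    simp only [Prod.mk.injEq] at hxx ⊢
    exact ⟨hxx.1, φ.injective hxx.2⟩
  · obtain ⟨x, hx, rfl, hxq⟩ := hsurj c (hc.trans hrr) (φ.symm q)
    exact ⟨x, ⟨hx, hc⟩, rfl, by simp [hxq]⟩
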